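/- Call a set of closed axis-parallel squares of side length $1$ in the plane a set of unit squares. Its intersection graph has the squares as vertices, two distinct squares being adjacent if and only if they intersect; the diameter of the graph is the largest distance between two vertices ($\infty$ if the graph is disconnected). There is a deterministic algorithm which, given any $n$ unit squares by the real coordinates of their centers, decides in $O(n\log n)$ time whether the diameter of their intersection graph is at most $2$. Here time is the number of elementary steps on a real RAM: a single program, the same for all inputs, works on finitely many arrays of natural numbers and of real numbers, and each constant, each indexed memory access, each addition or subtraction of natural numbers, each exact arithmetic operation $+,-,\times,/$ on reals, each comparison of two natural numbers or of two reals, each logical connective and each assignment takes one unit of time (there is no rounding of reals to integers). -/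

import Mathlib

/-! ### Unit square graphs -/

namespace UnitSquare

/-- The closed axis-parallel square of side length one with centre `c` in the plane. -/
def square (c : ℝ × ℝ) : Set (ℝ × ℝ) :=
  {p | |p.1 - c.1| ≤ 1 / 2 ∧ |p.2 - c.2| ≤ 1 / 2}

/-- The intersection graph of a set `F` of objects in the plane: its vertices are the members
of `F`, and two distinct members are adjacent if and only if they intersect. -/
def intersectionGraph (F : Set (Set (ℝ × ℝ))) : SimpleGraph F where
  Adj u v := u ≠ v ∧ ((u : Set (ℝ × ℝ)) ∩ (v : Set (ℝ × ℝ))).Nonempty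
  symm := ⟨fun _ _ h => ⟨h.1.symm, by rw [Set.inter_comm]; exact h.2⟩⟩
  loopless := ⟨fun _ h => h.1 rfl⟩

/-- The set of the unit squares whose centres are listed in `c`. -/
def squares {n : ℕ} (c : Fin n → ℝ × ℝ) : Set (Set (ℝ × ℝ)) :=
  Set.range fun i => square (c i)

end UnitSquare

/-! ### The real RAM

Programs are finite pieces of syntax. They work on finitely many one-dimensional arrays of
natural numbers and finitely many one-dimensional arrays of real numbers; arrays have fixed names
(the literal `a` below), and a scalar variable is the cell with index `0` of an array. Each
constant, each (indirect) memory access, each arithmetic operation, each comparison, each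
connective and each assignment costs one unit of time. Real cells hold exact real numbers and
allow the four arithmetic operations and comparison; there is no rounding and no conversion of
a real number into a natural number. Natural numbers, which serve as indices and counters, allow
only addition, subtraction and comparison. -/

namespace RealRAM

/-- A memory configuration: the cells of all arrays of natural numbers and of all arrays of real
numbers, addressed by the name of the array and the index of the cell. -/
structure State where
  nat : ℕ → ℕ → ℕ
  real : ℕ → ℕ → ℝ

/-- Expressions with a natural number as value. -/
inductive NExp where
  | const (k : ℕ)
  | get (a : ℕ) (i : NExp)
  | add (e f : NExp)
  | sub (e f : NExp)

/-- The value; subtraction is truncated at zero. -/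
def NExp.eval (s : State) : NExp → ℕ
  | .const k => k
  | .get a i => s.nat a (i.eval s)
  | .add e f => e.eval s + f.eval s
  | .sub e f => e.eval s - f.eval s

/-- The time needed to evaluate an expression. -/
def NExp.cost : NExp → ℕ
  | .const _ => 1
  | .get _ i => i.cost + 1
  | .add e f => e.cost + f.cost + 1
  | .sub e f => e.cost + f.cost + 1

/-- Expressions with a real number as value; only rational constants are available. -/
inductive RExp where
  | const (q : ℚ)
  | get (a : ℕ) (i : NExp)
  | add (e f : RExp)
  | sub (e f : RExp)
  | mul (e f : RExp)
  | div (e f : RExp)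

/-- The value; a division by zero yields zero. -/
noncomputable def RExp.eval (s : State) : RExp → ℝ
  | .const q => (q : ℝ)
  | .get a i => s.real a (i.eval s)
  | .add e f => e.eval s + f.eval s
  | .sub e f => e.eval s - f.eval s
  | .mul e f => e.eval s * f.eval s
  | .div e f => e.eval s / f.eval s

/-- The time needed to evaluate an expression. -/
def RExp.cost : RExp → ℕ
  | .const _ => 1
  | .get _ i => i.cost + 1
  | .add e f => e.cost + f.cost + 1
  | .sub e f => e.cost + f.cost + 1
  | .mul e f => e.cost + f.cost + 1
  | .div e f => e.cost + f.cost + 1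

/-- Tests. -/
inductive Test where
  | leNat (e f : NExp)
  | leReal (e f : RExp)
  | not (b : Test)
  | and (b c : Test)

/-- The test succeeds. -/
def Test.holds (s : State) : Test → Prop
  | .leNat e f => e.eval s ≤ f.eval s
  | .leReal e f => e.eval s ≤ f.eval s
  | .not b => ¬ b.holds s
  | .and b c => b.holds s ∧ c.holds s

/-- The time needed to evaluate a test. -/
def Test.cost : Test → ℕ
  | .leNat e f => e.cost + f.cost + 1
  | .leReal e f => e.cost + f.cost + 1
  | .not b => b.cost + 1
  | .and b c => b.cost + c.cost + 1

/-- Programs: the assignments `a[i] := e` for the two sorts of cells, sequential composition,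
branching and loops. -/
inductive Program where
  | skip
  | setNat (a : ℕ) (i : NExp) (e : NExp)
  | setReal (a : ℕ) (i : NExp) (e : RExp)
  | seq (p q : Program)
  | ite (b : Test) (p q : Program)
  | loop (b : Test) (p : Program)

/-- Write `v` into cell `i` of the array `a` of natural numbers. -/
def State.writeNat (s : State) (a i v : ℕ) : State :=
  { s with nat := Function.update s.nat a (Function.update (s.nat a) i v) }

/-- Write `v` into cell `i` of the array `a` of real numbers. -/
noncomputable def State.writeReal (s : State) (a i : ℕ) (v : ℝ) : State :=
  { s with real := Function.update s.real a (Function.update (s.real a) i v) }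

/-- `Exec p s t s'`: started in the configuration `s`, the program `p` halts after exactly `t`
units of time in the configuration `s'`. A program that runs forever has no such execution. -/
inductive Exec : Program → State → ℕ → State → Prop where
  | skip (s : State) : Exec .skip s 1 s
  | setNat (s : State) (a : ℕ) (i e : NExp) :
      Exec (.setNat a i e) s (i.cost + e.cost + 1) (s.writeNat a (i.eval s) (e.eval s))
  | setReal (s : State) (a : ℕ) (i : NExp) (e : RExp) :
      Exec (.setReal a i e) s (i.cost + e.cost + 1) (s.writeReal a (i.eval s) (e.eval s))
  | seq {p q : Program} {s₁ s₂ s₃ : State} {t u : ℕ} :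
      Exec p s₁ t s₂ → Exec q s₂ u s₃ → Exec (.seq p q) s₁ (t + u) s₃
  | iteTrue {b : Test} {p q : Program} {s s' : State} {t : ℕ} :
      b.holds s → Exec p s t s' → Exec (.ite b p q) s (b.cost + t) s'
  | iteFalse {b : Test} {p q : Program} {s s' : State} {t : ℕ} :
      ¬ b.holds s → Exec q s t s' → Exec (.ite b p q) s (b.cost + t) s'
  | loopDone {b : Test} {p : Program} {s : State} :
      ¬ b.holds s → Exec (.loop b p) s b.cost s
  | loopStep {b : Test} {p : Program} {s₁ s₂ s₃ : State} {t u : ℕ} :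
      b.holds s₁ → Exec p s₁ t s₂ → Exec (.loop b p) s₂ u s₃ →
        Exec (.loop b p) s₁ (b.cost + t + u) s₃

/-- The machine is deterministic: running time and final configuration are determined by the
program and the initial configuration. -/
theorem Exec.deterministic {p : Program} {s s₁ : State} {t₁ : ℕ} (h₁ : Exec p s t₁ s₁) :
    ∀ {s₂ : State} {t₂ : ℕ}, Exec p s t₂ s₂ → t₁ = t₂ ∧ s₁ = s₂ := by
  induction h₁ with
  | skip s => intro s₂ t₂ h; cases h; exact ⟨rfl, rfl⟩
  | setNat s a i e => intro s₂ t₂ h; cases h; exact ⟨rfl, rfl⟩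
  | setReal s a i e => intro s₂ t₂ h; cases h; exact ⟨rfl, rfl⟩
  | seq _ _ ih ih' =>
    intro s₂ t₂ h
    cases h with
    | seq g g' =>
      obtain ⟨rfl, rfl⟩ := ih g
      obtain ⟨rfl, rfl⟩ := ih' g'
      exact ⟨rfl, rfl⟩
  | iteTrue hb _ ih =>
    intro s₂ t₂ h
    cases h with
    | iteTrue _ g => obtain ⟨rfl, rfl⟩ := ih g; exact ⟨rfl, rfl⟩
    | iteFalse hn _ => exact absurd hb hn
  | iteFalse hb _ ih =>
    intro s₂ t₂ h
    cases h with
    | iteTrue hp _ => exact absurd hp hb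
    | iteFalse _ g => obtain ⟨rfl, rfl⟩ := ih g; exact ⟨rfl, rfl⟩
  | loopDone hb =>
    intro s₂ t₂ h
    cases h with
    | loopDone _ => exact ⟨rfl, rfl⟩
    | loopStep hp _ _ => exact absurd hp hb
  | loopStep hb _ _ ih ih' =>
    intro s₂ t₂ h
    cases h with
    | loopDone hn => exact absurd hb hn
    | loopStep _ g g' =>
      obtain ⟨rfl, rfl⟩ := ih g
      obtain ⟨rfl, rfl⟩ := ih' g'
      exact ⟨rfl, rfl⟩

/-- The initial configuration for a list of `n` points of the plane: cell `0` of the array `0` of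
natural numbers holds `n`, the real arrays `0` and `1` hold the first and the second coordinates
of the points in their first `n` cells, and all other cells hold zero. -/
def input {n : ℕ} (c : Fin n → ℝ × ℝ) : State where
  nat a i := if a = 0 ∧ i = 0 then n else 0
  real a i :=
    if h : i < n then
      if a = 0 then (c ⟨i, h⟩).1 else if a = 1 then (c ⟨i, h⟩).2 else 0
    else 0

/-- The answer read off a final configuration: cell `0` of the array `0` of natural numbers
(`1` means yes, `0` means no). -/
def State.answer (s : State) : ℕ := s.nat 0 0

end RealRAM

/-! ### Reasoning about programs -/

namespace RealRAM

/-! Two unit squares meet exactly when their centres differ by at most 1 in each coordinate. So the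
diameter is at most 2 iff any two centres have a common neighbour, each point counting as its own
neighbour (`ediam_le_two_iff`). If a coordinate spreads over more than 2, its extreme points have
none. Otherwise a translation puts all points into [-1,1]². Points in one closed quadrant are
adjacent, so only pairs in opposite halves matter: left/right or, with the coordinates exchanged,
bottom/top (`forall_linked_iff`).

Let a lie left and b right. A candidate p in the left half is horizontally close to a for free. If p
is on a's side of the horizontal axis, it is vertically close to a as well, so whether such a p
exists depends on b alone. If p is on the other side, a only bounds the distance of p from the axis,
so a suitable p exists iff the least such distance among the candidates compatible with b meets that
bound. For p in the right half the roles are exchanged. Hence a pair is bad iff one condition on a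
alone, one on b alone, and two strict inequalities, each comparing a number attached to a with one
attached to b, all hold (`badPair_iff`, `exists_badPair_iff`).

The least heights and the existence of bad pairs are both offline dominance queries: minimise a
value over the items whose key does not exceed that of the query. Points and queries are sorted
together, and prefix minima answer all queries in one sweep (`prefixMin_runs`). A constant number of
sorts of 2n keys by merge sort (`sort_runs`) gives the time bound. -/

@[simp]
theorem State.nat_writeNat (s : State) (a i v b j : ℕ) :
    (s.writeNat a i v).nat b j = if b = a ∧ j = i then v else s.nat b j := by
  by_cases h : b = a
  · subst h
    by_cases h' : j = i <;> simp [State.writeNat, h']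
  · simp [State.writeNat, h]

@[simp]
theorem State.real_writeNat (s : State) (a i v : ℕ) : (s.writeNat a i v).real = s.real := rfl

@[simp]
theorem State.real_writeReal (s : State) (a i : ℕ) (v : ℝ) (b j : ℕ) :
    (s.writeReal a i v).real b j = if b = a ∧ j = i then v else s.real b j := by
  by_cases h : b = a
  · subst h
    by_cases h' : j = i <;> simp [State.writeReal, h']
  · simp [State.writeReal, h]

@[simp]
theorem State.nat_writeReal (s : State) (a i : ℕ) (v : ℝ) : (s.writeReal a i v).nat = s.nat := rfl

namespace Program

/-- The program does not contain loops. -/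
def LoopFree : Program → Prop
  | .seq p q => p.LoopFree ∧ q.LoopFree
  | .ite _ p q => p.LoopFree ∧ q.LoopFree
  | .loop _ _ => False
  | _ => True

/-- An upper bound for the running time of a program without loops. -/
def cost : Program → ℕ
  | .skip => 1
  | .setNat _ i e => i.cost + e.cost + 1
  | .setReal _ i e => i.cost + e.cost + 1
  | .seq p q => p.cost + q.cost
  | .ite b p q => b.cost + p.cost + q.cost
  | .loop _ _ => 0

open Classical in
/-- The final configuration of a program without loops. -/
noncomputable def run : Program → State → State
  | .skip, s => s
  | .setNat a i e, s => s.writeNat a (i.eval s) (e.eval s)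
  | .setReal a i e, s => s.writeReal a (i.eval s) (e.eval s)
  | .seq p q, s => q.run (p.run s)
  | .ite b p q, s => if b.holds s then p.run s else q.run s
  | .loop _ _, s => s

/-- The program does not write into the array `a` of natural numbers. -/
def KeepsNat (a : ℕ) : Program → Prop
  | .setNat b _ _ => b ≠ a
  | .seq p q => p.KeepsNat a ∧ q.KeepsNat a
  | .ite _ p q => p.KeepsNat a ∧ q.KeepsNat a
  | .loop _ p => p.KeepsNat a
  | _ => True

/-- The program does not write into the array `a` of real numbers. -/
def KeepsReal (a : ℕ) : Program → Prop
  | .setReal b _ _ => b ≠ a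
  | .seq p q => p.KeepsReal a ∧ q.KeepsReal a
  | .ite _ p q => p.KeepsReal a ∧ q.KeepsReal a
  | .loop _ p => p.KeepsReal a
  | _ => True

theorem LoopFree.exec {p : Program} (h : p.LoopFree) (s : State) :
    ∃ t, Exec p s t (p.run s) ∧ t ≤ p.cost := by
  induction p generalizing s with
  | skip => exact ⟨_, .skip s, le_rfl⟩
  | setNat a i e => exact ⟨_, .setNat s a i e, le_rfl⟩
  | setReal a i e => exact ⟨_, .setReal s a i e, le_rfl⟩
  | seq p q ihp ihq =>
    obtain ⟨t, e, ht⟩ := ihp h.1 s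
    obtain ⟨u, f, hu⟩ := ihq h.2 (p.run s)
    exact ⟨_, .seq e f, Nat.add_le_add ht hu⟩
  | ite b p q ihp ihq =>
    by_cases hb : b.holds s
    · obtain ⟨t, e, ht⟩ := ihp h.1 s
      refine ⟨b.cost + t, ?_, ?_⟩
      · simp only [run, if_pos hb]; exact .iteTrue hb e
      · simp only [cost]; omega
    · obtain ⟨t, e, ht⟩ := ihq h.2 s
      refine ⟨b.cost + t, ?_, ?_⟩
      · simp only [run, if_neg hb]; exact .iteFalse hb e
      · simp only [cost]; omega
  | loop b p => exact h.elim

end Program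

theorem Exec.nat_eq {p : Program} {s s' : State} {t : ℕ} (h : Exec p s t s') {a : ℕ}
    (ha : p.KeepsNat a) : s'.nat a = s.nat a := by
  induction h with
  | skip | setReal | loopDone => rfl
  | setNat s b i e => exact Function.update_of_ne (Ne.symm ha) _ _
  | seq _ _ ih ih' => exact (ih' ha.2).trans (ih ha.1)
  | iteTrue _ _ ih => exact ih ha.1
  | iteFalse _ _ ih => exact ih ha.2
  | loopStep _ _ _ ih ih' => exact (ih' ha).trans (ih ha)

theorem Exec.real_eq {p : Program} {s s' : State} {t : ℕ} (h : Exec p s t s') {a : ℕ}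
    (ha : p.KeepsReal a) : s'.real a = s.real a := by
  induction h with
  | skip | setNat | loopDone => rfl
  | setReal s b i e => exact Function.update_of_ne (Ne.symm ha) _ _
  | seq _ _ ih ih' => exact (ih' ha.2).trans (ih ha.1)
  | iteTrue _ _ ih => exact ih ha.1
  | iteFalse _ _ ih => exact ih ha.2
  | loopStep _ _ _ ih ih' => exact (ih' ha).trans (ih ha)

theorem Program.LoopFree.nat_run {p : Program} (h : p.LoopFree) {a : ℕ} (ha : p.KeepsNat a)
    (s : State) : (p.run s).nat a = s.nat a := by
  obtain ⟨t, e, -⟩ := h.exec s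
  exact e.nat_eq ha

theorem Program.LoopFree.real_run {p : Program} (h : p.LoopFree) {a : ℕ} (ha : p.KeepsReal a)
    (s : State) : (p.run s).real a = s.real a := by
  obtain ⟨t, e, -⟩ := h.exec s
  exact e.real_eq ha

/-- Started in the configuration `s`, the program `p` halts within `T` units of time in a
configuration that satisfies `Q`. -/
def Runs (p : Program) (s : State) (T : ℕ) (Q : State → Prop) : Prop :=
  ∃ t s', Exec p s t s' ∧ t ≤ T ∧ Q s'

namespace Runs

variable {p q : Program} {s : State} {T U : ℕ} {Q R : State → Prop}

theorem mono (h : Runs p s T Q) (hT : T ≤ U) (hQ : ∀ s', Q s' → R s') : Runs p s U R := by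
  obtain ⟨t, s', e, ht, hq⟩ := h
  exact ⟨t, s', e, ht.trans hT, hQ s' hq⟩

theorem seq (hp : Runs p s T R) (hq : ∀ s', R s' → Runs q s' U Q) :
    Runs (.seq p q) s (T + U) Q := by
  obtain ⟨t, s', e, ht, hr⟩ := hp
  obtain ⟨u, s'', f, hu, h⟩ := hq s' hr
  exact ⟨_, s'', .seq e f, Nat.add_le_add ht hu, h⟩

theorem keepNat (h : Runs p s T Q) {a : ℕ} (ha : p.KeepsNat a) :
    Runs p s T fun s' => Q s' ∧ s'.nat a = s.nat a := by
  obtain ⟨t, s', e, ht, hq⟩ := h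
  exact ⟨t, s', e, ht, hq, e.nat_eq ha⟩

theorem keepReal (h : Runs p s T Q) {a : ℕ} (ha : p.KeepsReal a) :
    Runs p s T fun s' => Q s' ∧ s'.real a = s.real a := by
  obtain ⟨t, s', e, ht, hq⟩ := h
  exact ⟨t, s', e, ht, hq, e.real_eq ha⟩

theorem of_loopFree (hp : p.LoopFree) (h : Q (p.run s)) : Runs p s p.cost Q := by
  obtain ⟨t, e, ht⟩ := hp.exec s
  exact ⟨t, _, e, ht, h⟩

/-- A loop whose body is executed at most `m` times. -/
theorem loop {b : Test} {c m : ℕ} (I : ℕ → State → Prop)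
    (step : ∀ k s, I k s → b.holds s → k < m ∧ Runs p s c (I (k + 1))) :
    ∀ (d k : ℕ) (s : State), k + d = m → I k s →
      Runs (.loop b p) s (d * (b.cost + c) + b.cost)
        fun s' => ¬ b.holds s' ∧ ∃ k' ≤ m, I k' s' := by
  intro d
  induction d with
  | zero =>
    intro k s hk h
    by_cases hb : b.holds s
    · have := (step k s h hb).1
      omega
    · exact ⟨_, s, .loopDone hb, by simp, hb, k, by omega, h⟩
  | succ d ih =>
    intro k s hk h
    by_cases hb : b.holds s
    · obtain ⟨-, t, s', e, ht, h'⟩ := step k s h hb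
      obtain ⟨u, s'', f, hu, h''⟩ := ih (k + 1) s' (by omega) h'
      refine ⟨_, s'', .loopStep hb e f, ?_, h''⟩
      rw [Nat.succ_mul]
      omega
    · exact ⟨_, s, .loopDone hb, by omega, hb, k, by omega, h⟩

end Runs

/-- The scalar variable stored in the array `a` of natural numbers. -/
def NExp.var (a : ℕ) : NExp := .get a (.const 0)

@[simp]
theorem NExp.eval_var (s : State) (a : ℕ) : (NExp.var a).eval s = s.nat a 0 := rfl

/-- Execute `body` with the variable `i` running from `0` to the value of the variable `b`,
exclusively. -/
def Program.forRange (i b : ℕ) (body : Program) : Program :=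
  .seq (.setNat i (.const 0) (.const 0))
    (.loop (.leNat (.add (.var i) (.const 1)) (.var b))
      (.seq body (.setNat i (.const 0) (.add (.var i) (.const 1)))))

/-- The body writes neither the counter nor its bound, so the invariant is indexed by the counter
itself. The constant 20 pays for test, increment and initialisation. -/
theorem Runs.forRange {i b : ℕ} {body : Program} (hib : i ≠ b) (hf : body.LoopFree)
    (hi : body.KeepsNat i) (hb : body.KeepsNat b) (I : ℕ → State → Prop) (s : State)
    (h0 : I 0 (s.writeNat i 0 0))
    (step : ∀ k s', k < s.nat b 0 → s'.nat i 0 = k → s'.nat b 0 = s.nat b 0 → I k s' →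
      I (k + 1) ((body.run s').writeNat i 0 (k + 1))) :
    Runs (.forRange i b body) s ((body.cost + 20) * (s.nat b 0 + 1)) (I (s.nat b 0)) := by
  have hcond (s' : State) : Test.holds s' (.leNat (.add (.var i) (.const 1)) (.var b)) ↔
      s'.nat i 0 < s'.nat b 0 := Iff.rfl
  have init : Runs (.setNat i (.const 0) (.const 0)) s 3 fun s' =>
      s'.nat i 0 = 0 ∧ s'.nat b 0 = s.nat b 0 ∧ I 0 s' :=
    ⟨_, _, .setNat _ _ _ _, by simp [NExp.cost], by simp [NExp.eval],
      by simp [hib.symm], h0⟩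
  refine (init.seq fun s₁ h₁ => Runs.loop (c := body.cost + 6)
    (fun k s' => s'.nat i 0 = k ∧ s'.nat b 0 = s.nat b 0 ∧ k ≤ s.nat b 0 ∧ I k s')
    (m := s.nat b 0) ?_ (s.nat b 0) 0 s₁ (by simp) ⟨h₁.1, h₁.2.1, by simp, h₁.2.2⟩).mono ?_ ?_
  · rintro k s' ⟨hk, hn, -, hI⟩ hlt
    rw [hcond, hk, hn] at hlt
    refine ⟨hlt, ?_⟩
    have hbody : Runs body s' body.cost fun s'' => s'' = body.run s' := .of_loopFree hf rfl
    refine (((hbody.keepNat hi).keepNat hb).seq (U := 6)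
      (Q := fun s'' => s''.nat i 0 = k + 1 ∧ s''.nat b 0 = s.nat b 0 ∧ k + 1 ≤ s.nat b 0 ∧
        I (k + 1) s'') ?_)
    rintro s'' ⟨⟨rfl, h1⟩, h2⟩
    refine ⟨_, _, .setNat _ _ _ _, by simp [NExp.cost, NExp.var], ?_⟩
    have : NExp.eval (body.run s') (.add (.var i) (.const 1)) = k + 1 := by
      simp [NExp.eval, h1, hk]
    rw [this]
    refine ⟨by simp [NExp.eval], ?_, hlt, ?_⟩
    · simp [hib.symm, h2, hn]
    · exact step k s' hlt hk hn hI
  · simp only [Test.cost, NExp.cost, NExp.var]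
    nlinarith
  · rintro s' ⟨hlt, k, hk, h1, h2, -, hI⟩
    rw [hcond, h1, h2] at hlt
    rwa [show s.nat b 0 = k by omega]

end RealRAM

/-! ### Merge sort -/

/-- Comparison of indices by their keys, ties being broken by the indices themselves. -/
def KeyLE (K : ℕ → ℝ) (u v : ℕ) : Prop :=
  K u ≤ K v ∧ (K v ≤ K u → u ≤ v)

namespace KeyLE

variable {K : ℕ → ℝ} {u v w : ℕ}

/-- Totality. With `trans` and `antisymm` the key order is linear, so preceding in this order and
having an earlier sorted position are the same. -/
theorem of_not (h : ¬ KeyLE K u v) : KeyLE K v u := by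
  unfold KeyLE at *
  by_cases h1 : K u ≤ K v
  · have h2 : ¬ (K v ≤ K u → u ≤ v) := fun h2 => h ⟨h1, h2⟩
    push Not at h2
    exact ⟨h2.1, fun _ => h2.2.le⟩
  · exact ⟨(not_le.1 h1).le, fun h2 => absurd h2 h1⟩

theorem refl (K : ℕ → ℝ) (u : ℕ) : KeyLE K u u := ⟨le_rfl, fun _ => le_rfl⟩

theorem trans (h : KeyLE K u v) (h' : KeyLE K v w) : KeyLE K u w :=
  ⟨h.1.trans h'.1, fun h2 => (h.2 (h'.1.trans h2)).trans (h'.2 (h2.trans h.1))⟩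

theorem antisymm (h : KeyLE K u v) (h' : KeyLE K v u) : u = v :=
  le_antisymm (h.2 h'.1) (h'.2 h.1)

end KeyLE

/-- On each block of `w` consecutive positions below `N`, the sequence `σ` is sorted by keys. -/
def BlockSorted (K : ℕ → ℝ) (w N : ℕ) (σ : ℕ → ℕ) : Prop :=
  ∀ u v, u ≤ v → v < N → u / w = v / w → KeyLE K (σ u) (σ v)

/-- The sequence `σ` maps the numbers below `N` onto themselves. -/
def Onto (N : ℕ) (σ : ℕ → ℕ) : Prop :=
  (∀ u < N, σ u < N) ∧ ∀ x < N, ∃ u < N, σ u = x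

/-- A surjection of a finite set onto itself is injective; hence the merge invariant only has to
record that no entry is lost. -/
theorem Onto.injective {N : ℕ} {σ : ℕ → ℕ} (h : Onto N σ) {u v : ℕ} (hu : u < N) (hv : v < N)
    (huv : σ u = σ v) : u = v := by
  let f : Fin N → Fin N := fun x => ⟨σ x, h.1 x x.2⟩
  have hf : Function.Surjective f := fun y => by
    obtain ⟨x, hx, e⟩ := h.2 y y.2
    exact ⟨⟨x, hx⟩, Fin.ext e⟩
  have : (⟨u, hu⟩ : Fin N) = ⟨v, hv⟩ := Finite.injective_iff_surjective.2 hf (Fin.ext huv)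
  exact congrArg Fin.val this

/-- The situation while the blocks of length `w` of `σ` are merged pairwise into `τ`: the block
pair that starts at `q * (2 * w)` is being processed, `k` entries have been written, and the
next entries to be read are those at `i` and `j`. -/
structure MergeInv (K : ℕ → ℝ) (σ : ℕ → ℕ) (N w q k i j : ℕ) (τ : ℕ → ℕ) : Prop where
  lo_le_k : q * (2 * w) ≤ k
  k_le : k ≤ q * (2 * w) + 2 * w
  lo_le_i : q * (2 * w) ≤ i
  i_le : i ≤ q * (2 * w) + w
  le_j : q * (2 * w) + w ≤ j
  j_le : j ≤ q * (2 * w) + 2 * w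
  add_eq : i + j = k + (q * (2 * w) + w)
  j_le' : j ≤ N ∨ j = q * (2 * w) + w
  sorted : BlockSorted K (2 * w) k τ
  le_left : ∀ u v, q * (2 * w) ≤ u → u < k → i ≤ v → v < q * (2 * w) + w → v < N →
    KeyLE K (τ u) (σ v)
  le_right : ∀ u v, q * (2 * w) ≤ u → u < k → j ≤ v → v < q * (2 * w) + 2 * w → v < N →
    KeyLE K (τ u) (σ v)
  lt : ∀ u < k, τ u < N
  cover : ∀ x < N, (∃ u < k, τ u = x) ∨
    ∃ v < N, (i ≤ v ∧ v < q * (2 * w) + w ∨ j ≤ v) ∧ σ v = x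

namespace MergeInv

variable {K : ℕ → ℝ} {σ τ : ℕ → ℕ} {N w q k i j : ℕ}

theorem init (hw : 0 < w) (hσ : Onto N σ) : MergeInv K σ N w 0 0 0 w τ where
  lo_le_k := by simp
  k_le := by omega
  lo_le_i := by simp
  i_le := by simp
  le_j := by simp
  j_le := by omega
  add_eq := by simp
  j_le' := by simp
  sorted := fun u v _ h => by omega
  le_left := fun u v _ h => by omega
  le_right := fun u v _ h => by omega
  lt := by simp
  cover := fun x hx => by
    obtain ⟨v, hv, e⟩ := hσ.2 x hx
    exact .inr ⟨v, hv, by omega, e⟩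

theorem left_div {u : ℕ} (h : u < q * (2 * w) + w) (h' : q * (2 * w) ≤ u) :
    u / w = 2 * q := by
  apply Nat.div_eq_of_lt_le <;> nlinarith

theorem right_div {u : ℕ} (h : u < q * (2 * w) + 2 * w) (h' : q * (2 * w) + w ≤ u) :
    u / w = 2 * q + 1 := by
  apply Nat.div_eq_of_lt_le <;> nlinarith

theorem pair_div {u : ℕ} (h : u < q * (2 * w) + 2 * w) (h' : q * (2 * w) ≤ u) :
    u / (2 * w) = q := by
  apply Nat.div_eq_of_lt_le <;> nlinarith

/-- Appending an entry that dominates everything in the current block pair keeps `τ` sorted. -/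
theorem sorted_update (h : MergeInv K σ N w q k i j τ) (hk : k < q * (2 * w) + 2 * w) {x : ℕ}
    (hx : ∀ u, q * (2 * w) ≤ u → u < k → KeyLE K (τ u) x) :
    BlockSorted K (2 * w) (k + 1) (Function.update τ k x) := by
  intro u v huv hv hd
  rcases Nat.lt_succ_iff_lt_or_eq.1 hv with hv | rfl
  · rw [Function.update_of_ne (by omega), Function.update_of_ne (by omega)]
    exact h.sorted u v huv hv hd
  · rw [Function.update_self]
    rcases huv.lt_or_eq with hu | rfl
    · rw [Function.update_of_ne (by omega)]
      refine hx u ?_ hu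
      rw [pair_div hk h.lo_le_k] at hd
      rw [← hd]
      exact Nat.div_mul_le_self u (2 * w)
    · rw [Function.update_self]
      exact KeyLE.refl K x

/-- The entry copied dominates all that is written of this pair. It precedes the rest of its own
block by sortedness, and the rest of the right block by the comparison and transitivity. -/
theorem step_left (h : MergeInv K σ N w q k i j τ) (hs : BlockSorted K w N σ) (hσ : Onto N σ)
    (hkN : k < N) (hk : k < q * (2 * w) + 2 * w) (hi : i < q * (2 * w) + w)
    (hr : q * (2 * w) + 2 * w ≤ j ∨ N ≤ j ∨ KeyLE K (σ i) (σ j)) :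
    MergeInv K σ N w q (k + 1) (i + 1) j (Function.update τ k (σ i)) := by
  -- The position `j` is at least the start of the right block, so `add_eq` gives `i ≤ k < N`.
  have hiN : i < N := by
    have := h.add_eq
    have := h.j_le'
    have := h.le_j
    omega
  have hd := left_div hi h.lo_le_i
  refine ⟨h.lo_le_k.trans (Nat.le_succ k), hk, h.lo_le_i.trans (Nat.le_succ i), hi, h.le_j,
    h.j_le, by have := h.add_eq; omega, h.j_le',
    h.sorted_update hk fun u hu hu' => h.le_left u i hu hu' le_rfl hi hiN, ?_, ?_, ?_, ?_⟩
  · intro u v hu hu' hv hv' hvN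
    rcases Nat.lt_succ_iff_lt_or_eq.1 hu' with hu' | rfl
    · rw [Function.update_of_ne (by omega)]
      exact h.le_left u v hu hu' (by omega) hv' hvN
    · rw [Function.update_self]
      exact hs i v (by omega) hvN (by rw [hd, left_div hv' (h.lo_le_i.trans (by omega))])
  · intro u v hu hu' hv hv' hvN
    rcases Nat.lt_succ_iff_lt_or_eq.1 hu' with hu' | rfl
    · rw [Function.update_of_ne (by omega)]
      exact h.le_right u v hu hu' hv hv' hvN
    · rw [Function.update_self]
      rcases hr with hr | hr | hr
      · omega
      · omega
      · refine hr.trans (hs j v hv hvN ?_)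
        rw [right_div (by omega) h.le_j, right_div hv' (h.le_j.trans hv)]
  · intro u hu
    rcases Nat.lt_succ_iff_lt_or_eq.1 hu with hu | rfl
    · rw [Function.update_of_ne (by omega)]
      exact h.lt u hu
    · rw [Function.update_self]
      exact hσ.1 i hiN
  · intro x hx
    rcases h.cover x hx with ⟨u, hu, e⟩ | ⟨v, hv, hv', e⟩
    · exact .inl ⟨u, by omega, by rwa [Function.update_of_ne (by omega)]⟩
    · rcases eq_or_ne v i with rfl | hne
      · exact .inl ⟨k, by omega, by rwa [Function.update_self]⟩
      · exact .inr ⟨v, hv, by omega, e⟩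

theorem step_right (h : MergeInv K σ N w q k i j τ) (hs : BlockSorted K w N σ) (hσ : Onto N σ)
    (hk : k < q * (2 * w) + 2 * w) (hj : j < q * (2 * w) + 2 * w) (hjN : j < N)
    (hr : q * (2 * w) + w ≤ i ∨ KeyLE K (σ j) (σ i)) :
    MergeInv K σ N w q (k + 1) i (j + 1) (Function.update τ k (σ j)) := by
  have hd := right_div hj h.le_j
  refine ⟨h.lo_le_k.trans (Nat.le_succ k), hk, h.lo_le_i, h.i_le, h.le_j.trans (Nat.le_succ j),
    hj, by have := h.add_eq; omega, .inl hjN,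
    h.sorted_update hk fun u hu hu' => h.le_right u j hu hu' le_rfl hj hjN, ?_, ?_, ?_, ?_⟩
  · intro u v hu hu' hv hv' hvN
    rcases Nat.lt_succ_iff_lt_or_eq.1 hu' with hu' | rfl
    · rw [Function.update_of_ne (by omega)]
      exact h.le_left u v hu hu' hv hv' hvN
    · rw [Function.update_self]
      rcases hr with hr | hr
      · omega
      · refine hr.trans (hs i v hv hvN ?_)
        rw [left_div (by omega) h.lo_le_i, left_div hv' (h.lo_le_i.trans hv)]
  · intro u v hu hu' hv hv' hvN
    rcases Nat.lt_succ_iff_lt_or_eq.1 hu' with hu' | rfl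
    · rw [Function.update_of_ne (by omega)]
      exact h.le_right u v hu hu' (by omega) hv' hvN
    · rw [Function.update_self]
      refine hs j v (by omega) hvN ?_
      have := h.le_j
      rw [hd, right_div hv' (by omega)]
  · intro u hu
    rcases Nat.lt_succ_iff_lt_or_eq.1 hu with hu | rfl
    · rw [Function.update_of_ne (by omega)]
      exact h.lt u hu
    · rw [Function.update_self]
      exact hσ.1 j hjN
  · intro x hx
    rcases h.cover x hx with ⟨u, hu, e⟩ | ⟨v, hv, hv', e⟩
    · exact .inl ⟨u, by omega, by rwa [Function.update_of_ne (by omega)]⟩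
    · rcases eq_or_ne v j with rfl | hne
      · exact .inl ⟨k, by omega, by rwa [Function.update_self]⟩
      · exact .inr ⟨v, hv, by omega, e⟩

/-- Begin with the next pair of blocks when the current one is exhausted. -/
theorem next (h : MergeInv K σ N w q k i j τ) (hk : q * (2 * w) + 2 * w ≤ k) :
    MergeInv K σ N w (q + 1) k k (k + w) τ := by
  have hq : (q + 1) * (2 * w) = q * (2 * w) + 2 * w := Nat.succ_mul _ _
  obtain ⟨h1, h2, h3, h4, h5, h6, h7, h8, h9, h10, h11, h12, h13⟩ := h
  refine ⟨by omega, by omega, by omega, by omega, by omega, by omega, by omega, by omega, h9,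
    fun u v _ _ => by omega, fun u v _ _ => by omega, h12, fun x hx => ?_⟩
  rcases h13 x hx with h | ⟨v, hv, hv', e⟩
  · exact .inl h
  · exact .inr ⟨v, hv, by omega, e⟩

/-- With `k = N`, `add_eq` forces `j ≥ N`. If the left block is not exhausted, then `j > N`, so
`j_le'` makes `j` the start of the right block and `i = N`. Nothing below `N` remains unread. -/
theorem onto (h : MergeInv K σ N w q N i j τ) : Onto N τ := by
  refine ⟨h.lt, fun x hx => ?_⟩
  rcases h.cover x hx with h' | ⟨v, hv, hv', -⟩
  · exact h'
  · have := h.add_eq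
    have := h.j_le'
    have := h.i_le
    omega

end MergeInv

theorem BlockSorted.congr {K : ℕ → ℝ} {w N : ℕ} {σ τ : ℕ → ℕ} (h : BlockSorted K w N σ)
    (e : ∀ u < N, τ u = σ u) : BlockSorted K w N τ := by
  intro u v huv hv hd
  rw [e u (by omega), e v hv]
  exact h u v huv hv hd

theorem Onto.congr {N : ℕ} {σ τ : ℕ → ℕ} (h : Onto N σ) (e : ∀ u < N, τ u = σ u) : Onto N τ := by
  refine ⟨fun u hu => by rw [e u hu]; exact h.1 u hu, fun x hx => ?_⟩
  obtain ⟨u, hu, hx⟩ := h.2 x hx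
  exact ⟨u, hu, by rw [e u hu, hx]⟩

/-! ### The merge sort program and its running time -/

namespace RealRAM

/-- Comparison of the keys in the real array `2`, with ties broken by the indices. -/
def keyTest (u v : NExp) : Test :=
  .and (.leReal (.get 2 u) (.get 2 v)) (.not (.and (.leReal (.get 2 v) (.get 2 u))
    (.not (.leNat u v))))

theorem keyTest_holds (s : State) (u v : NExp) :
    (keyTest u v).holds s ↔ KeyLE (s.real 2) (u.eval s) (v.eval s) := by
  simp only [keyTest, Test.holds, RExp.eval, KeyLE, not_and, not_not]

namespace Program

/-- Copy the next entry in a merge. The sequence to be sorted is in the array `4`, the merged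
sequence in the array `5`. The variables are: `3` the number of entries, `6` the block length,
`7` the position to be written, `8` and `9` the positions to be read, `10` and `11` the ends of the
current two blocks. -/
def mergeTake : Program :=
    (.ite (.and (.leNat (.add (.var 8) (.const 1)) (.var 10))
        (.not (.and
          (.and (.leNat (.add (.var 9) (.const 1)) (.var 11))
            (.leNat (.add (.var 9) (.const 1)) (.var 3)))
          (.not (keyTest (.get 4 (.var 8)) (.get 4 (.var 9)))))))
      (.seq (.setNat 5 (.var 7) (.get 4 (.var 8)))
        (.setNat 8 (.const 0) (.add (.var 8) (.const 1))))
      (.seq (.setNat 5 (.var 7) (.get 4 (.var 9)))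
        (.setNat 9 (.const 0) (.add (.var 9) (.const 1)))))

/-- One merge step: copy an entry, and move on to the next two blocks when it was the last. -/
def mergeStep : Program :=
  .seq mergeTake
    (.ite (.leNat (.var 11) (.add (.var 7) (.const 1)))
      (.seq (.setNat 8 (.const 0) (.var 11))
        (.seq (.setNat 10 (.const 0) (.add (.var 11) (.var 6)))
          (.seq (.setNat 9 (.const 0) (.var 10))
            (.setNat 11 (.const 0) (.add (.var 10) (.var 6))))))
      .skip)

/-- Merge the blocks in pairs and double the block length. -/
def mergePass : Program :=
  .seq
    (.seq (.setNat 8 (.const 0) (.const 0))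
      (.seq (.setNat 9 (.const 0) (.var 6))
        (.seq (.setNat 10 (.const 0) (.var 6))
          (.setNat 11 (.const 0) (.add (.var 6) (.var 6))))))
    (.seq (.forRange 7 3 mergeStep)
      (.seq (.forRange 7 3 (.setNat 4 (.var 7) (.get 5 (.var 7))))
        (.setNat 6 (.const 0) (.add (.var 6) (.var 6)))))

/-- Sort the indices below the value of the variable `3` by their keys in the real array `2`. -/
def sort : Program :=
  .seq (.forRange 7 3 (.setNat 4 (.var 7) (.var 7)))
    (.seq (.setNat 6 (.const 0) (.const 1))
      (.loop (.leNat (.add (.var 6) (.const 1)) (.var 3)) mergePass))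

end Program

open Program

theorem loopFree_mergeTake : mergeTake.LoopFree := by
  simp [mergeTake, LoopFree]

theorem loopFree_mergeStep : mergeStep.LoopFree := by
  simp [mergeStep, mergeTake, LoopFree]

theorem mergeTake_run {s : State} {q N w : ℕ}
    (hs : BlockSorted (s.real 2) w N (s.nat 4)) (hσ : Onto N (s.nat 4)) (h3 : s.nat 3 0 = N)
    (hkN : s.nat 7 0 < N) (hk : s.nat 7 0 < q * (2 * w) + 2 * w)
    (h10 : s.nat 10 0 = q * (2 * w) + w) (h11 : s.nat 11 0 = q * (2 * w) + 2 * w)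
    (hI : MergeInv (s.real 2) (s.nat 4) N w q (s.nat 7 0) (s.nat 8 0) (s.nat 9 0) (s.nat 5)) :
    MergeInv (s.real 2) (s.nat 4) N w q (s.nat 7 0 + 1) ((mergeTake.run s).nat 8 0)
      ((mergeTake.run s).nat 9 0) ((mergeTake.run s).nat 5) := by
  classical
  have upd (x : ℕ) : (fun j => if j = s.nat 7 0 then x else s.nat 5 j) =
      Function.update (s.nat 5) (s.nat 7 0) x := by
    funext j
    rw [Function.update_apply]
  by_cases hc : s.nat 8 0 < s.nat 10 0 ∧
      (s.nat 9 0 < s.nat 11 0 → s.nat 9 0 < s.nat 3 0 →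
        KeyLE (s.real 2) (s.nat 4 (s.nat 8 0)) (s.nat 4 (s.nat 9 0)))
  · have e : mergeTake.run s = (s.writeNat 5 (s.nat 7 0) (s.nat 4 (s.nat 8 0))).writeNat 8 0
        (s.nat 8 0 + 1) := by
      simp [mergeTake, run, Test.holds, NExp.eval, keyTest_holds, hc]
      intro h1 h2 h3
      exact absurd (hc.2 h1 h2) h3
    have e5 : (mergeTake.run s).nat 5 =
        Function.update (s.nat 5) (s.nat 7 0) (s.nat 4 (s.nat 8 0)) := by
      rw [← upd, e]
      funext j
      simp
    have e8 : (mergeTake.run s).nat 8 0 = s.nat 8 0 + 1 := by simp [e]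
    have e9 : (mergeTake.run s).nat 9 0 = s.nat 9 0 := by simp [e]
    rw [e5, e8, e9]
    refine hI.step_left hs hσ hkN hk (by omega) ?_
    by_contra! hcon
    exact hcon.2.2 (hc.2 (by omega) (by omega))
  · have e : mergeTake.run s = (s.writeNat 5 (s.nat 7 0) (s.nat 4 (s.nat 9 0))).writeNat 9 0
        (s.nat 9 0 + 1) := by
      simp [mergeTake, run, Test.holds, NExp.eval, keyTest_holds]
      intro h1 h2
      exact absurd ⟨h1, h2⟩ hc
    have e5 : (mergeTake.run s).nat 5 =
        Function.update (s.nat 5) (s.nat 7 0) (s.nat 4 (s.nat 9 0)) := by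
      rw [← upd, e]
      funext j
      simp
    have e9 : (mergeTake.run s).nat 9 0 = s.nat 9 0 + 1 := by simp [e]
    have e8 : (mergeTake.run s).nat 8 0 = s.nat 8 0 := by simp [e]
    rw [e5, e8, e9]
    have h1 := hI.add_eq
    have h2 := hI.i_le
    have h3 := hI.le_j
    have h4 := hI.j_le
    have h5 := hI.lo_le_i
    by_cases hi : s.nat 8 0 + 1 ≤ s.nat 10 0
    · have hc' : s.nat 9 0 + 1 ≤ s.nat 11 0 ∧ s.nat 9 0 + 1 ≤ s.nat 3 0 ∧
          ¬ KeyLE (s.real 2) (s.nat 4 (s.nat 8 0)) (s.nat 4 (s.nat 9 0)) := by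
        by_contra! hcon
        exact hc ⟨hi, hcon⟩
      exact hI.step_right hs hσ hk (by omega) (by omega) (.inr (.of_not hc'.2.2))
    -- The left block is exhausted, so `add_eq` gives `j = k < N`: there is an entry to read on the
    -- right.
    · exact hI.step_right hs hσ hk (by omega) (by omega) (.inl (by omega))

/-- The pair number `q` occurs only in the proof; the machine cannot multiply naturals and stores
the ends of the two blocks instead. Moving on at once keeps the write position strictly below the
end of the current pair. -/
theorem mergeStep_run {s : State} {N w : ℕ} (hw : 0 < w) (h6 : s.nat 6 0 = w)
    (hs : BlockSorted (s.real 2) w N (s.nat 4)) (hσ : Onto N (s.nat 4)) (h3 : s.nat 3 0 = N)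
    (hkN : s.nat 7 0 < N)
    (hI : ∃ q, s.nat 10 0 = q * (2 * w) + w ∧ s.nat 11 0 = q * (2 * w) + 2 * w ∧
      s.nat 7 0 < q * (2 * w) + 2 * w ∧
      MergeInv (s.real 2) (s.nat 4) N w q (s.nat 7 0) (s.nat 8 0) (s.nat 9 0) (s.nat 5)) :
    ∃ q, (mergeStep.run s).nat 10 0 = q * (2 * w) + w ∧
      (mergeStep.run s).nat 11 0 = q * (2 * w) + 2 * w ∧
      s.nat 7 0 + 1 < q * (2 * w) + 2 * w ∧
      MergeInv (s.real 2) (s.nat 4) N w q (s.nat 7 0 + 1) ((mergeStep.run s).nat 8 0)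
        ((mergeStep.run s).nat 9 0) ((mergeStep.run s).nat 5) := by
  obtain ⟨q, h10, h11, hk, hI⟩ := hI
  have hI' := mergeTake_run hs hσ h3 hkN hk h10 h11 hI
  have f6 := loopFree_mergeTake.nat_run (a := 6) (by simp [mergeTake, KeepsNat]) s
  have f7 := loopFree_mergeTake.nat_run (a := 7) (by simp [mergeTake, KeepsNat]) s
  have f10 := loopFree_mergeTake.nat_run (a := 10) (by simp [mergeTake, KeepsNat]) s
  have f11 := loopFree_mergeTake.nat_run (a := 11) (by simp [mergeTake, KeepsNat]) s
  set s₁ := mergeTake.run s with hs₁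
  rw [← f6] at h6
  rw [← f10] at h10
  rw [← f11] at h11
  rw [← f7] at hI' hk ⊢
  simp only [mergeStep, run, ← hs₁]
  by_cases hc : s₁.nat 11 0 ≤ s₁.nat 7 0 + 1
  · have hq : (q + 1) * (2 * w) = q * (2 * w) + 2 * w := Nat.succ_mul _ _
    have ek : s₁.nat 7 0 + 1 = s₁.nat 11 0 := by omega
    refine ⟨q + 1, ?_, ?_, ?_, ?_⟩
    · simp [Test.holds, NExp.eval, hc]; omega
    · simp [Test.holds, NExp.eval, hc]; omega
    · omega
    · have := hI'.next (by omega)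
      rw [ek] at this ⊢
      convert this using 1 <;> [skip; skip; funext j] <;> simp [Test.holds, NExp.eval, ek, h6]
  · refine ⟨q, ?_, ?_, by omega, ?_⟩ <;>
      simp only [Test.holds, NExp.eval, hc, NExp.eval_var, if_false] <;> assumption

theorem mergePass_runs {s : State} {N w : ℕ} (hw : 0 < w) (h6 : s.nat 6 0 = w)
    (hs : BlockSorted (s.real 2) w N (s.nat 4)) (hσ : Onto N (s.nat 4)) (h3 : s.nat 3 0 = N) :
    Runs mergePass s (300 * (N + 1)) fun s' => s'.nat 6 0 = 2 * w ∧ s'.nat 3 0 = N ∧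
      s'.real 2 = s.real 2 ∧ BlockSorted (s.real 2) (2 * w) N (s'.nat 4) ∧ Onto N (s'.nat 4) := by
  have keep3 : mergeStep.KeepsNat 3 := by simp [mergeStep, mergeTake, KeepsNat]
  have keep4 : mergeStep.KeepsNat 4 := by simp [mergeStep, mergeTake, KeepsNat]
  have keep6 : mergeStep.KeepsNat 6 := by simp [mergeStep, mergeTake, KeepsNat]
  have keep7 : mergeStep.KeepsNat 7 := by simp [mergeStep, mergeTake, KeepsNat]
  have keepR : mergeStep.KeepsReal 2 := by simp [mergeStep, mergeTake, KeepsReal]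
  rw [mergePass]
  refine ((Runs.of_loopFree (Q := fun s' => s'.nat 3 = s.nat 3 ∧ s'.nat 4 = s.nat 4 ∧
    s'.nat 6 0 = w ∧ s'.real 2 = s.real 2 ∧ s'.nat 8 0 = 0 ∧ s'.nat 9 0 = w ∧ s'.nat 10 0 = w ∧
    s'.nat 11 0 = 2 * w) ?_ ?_).seq (U := 250 * (N + 1)) ?_).mono ?_ fun _ h => h
  · simp [LoopFree]
  · simp [run, NExp.eval, h6, two_mul, funext_iff]
  rotate_left
  · simp only [cost, NExp.cost, NExp.var]; omega
  rintro s₁ ⟨a3, a4, a6, aR, a8, a9, a10, a11⟩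
  rw [← aR, ← a4] at hs
  rw [← a4] at hσ
  have n3 : s₁.nat 3 0 = N := by rw [a3, h3]
  refine ((Runs.forRange (by decide) loopFree_mergeStep keep7 keep3
    (fun k s' => s'.nat 4 = s₁.nat 4 ∧ s'.nat 6 0 = w ∧ s'.real 2 = s₁.real 2 ∧
      ∃ q, s'.nat 10 0 = q * (2 * w) + w ∧ s'.nat 11 0 = q * (2 * w) + 2 * w ∧
      k < q * (2 * w) + 2 * w ∧
      MergeInv (s₁.real 2) (s₁.nat 4) N w q k (s'.nat 8 0) (s'.nat 9 0) (s'.nat 5)) s₁ ?_ ?_).keepNat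
        (a := 3) (by simp [forRange, keep3, KeepsNat])).seq
        (U := 80 * (N + 1)) ?_ |>.mono ?_ fun _ h => h
  · refine ⟨by simp [funext_iff], by simp [a6], rfl, 0, by simp [a10], by simp [a11], by omega, ?_⟩
    have e8 : (s₁.writeNat 7 0 0).nat 8 0 = 0 := by simp [a8]
    have e9 : (s₁.writeNat 7 0 0).nat 9 0 = w := by simp [a9]
    rw [e8, e9]
    exact .init hw hσ
  · rintro k s' hk h7 h3' ⟨b4, b6, bR, hI⟩
    have f4 := loopFree_mergeStep.nat_run keep4 s'
    have f6 := loopFree_mergeStep.nat_run keep6 s'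
    have fR := loopFree_mergeStep.real_run keepR s'
    refine ⟨?_, by simp [f6, b6], ?_, ?_⟩
    · rw [← b4, ← f4]; simp [funext_iff]
    · rw [← bR, ← fR]; rfl
    · rw [← b4, ← bR] at hI hs ⊢
      rw [← b4] at hσ
      rw [← h7] at hI ⊢
      obtain ⟨q, i1, i2, i3, i4⟩ := mergeStep_run hw b6 hs hσ (h3'.trans n3) (by omega) hI
      refine ⟨q, by simpa using i1, by simpa using i2, i3, ?_⟩
      convert i4 using 1 <;> simp [funext_iff]
  · rintro s₂ ⟨⟨b4, b6, bR, q, -, -, -, hI⟩, b3⟩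
    have m3 : s₂.nat 3 0 = N := by rw [b3, n3]
    rw [n3] at hI
    refine ((Runs.forRange (by decide) (by simp [LoopFree]) (by simp [KeepsNat])
      (by simp [KeepsNat]) (fun k s' => s'.nat 5 = s₂.nat 5 ∧ s'.real 2 = s₂.real 2 ∧
        s'.nat 6 0 = w ∧ ∀ u < k, s'.nat 4 u = s₂.nat 5 u) s₂ ?_ ?_).keepNat
        (a := 3) (by simp [forRange, KeepsNat])).seq
        (U := 30) ?_ |>.mono ?_ fun _ h => h
    · refine ⟨by simp [funext_iff], rfl, by simp [b6], by simp⟩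
    · rintro k s' - h7 - ⟨c5, cR, c6, c4⟩
      refine ⟨?_, by simpa [run] using cR, by simpa [run] using c6, ?_⟩
      · rw [← c5]; simp [funext_iff, run]
      · intro u hu
        by_cases huk : u = k
        · simp [run, NExp.eval, h7, huk, c5]
        · simp [run, NExp.eval, h7, huk, c4 u (by omega)]
    · rintro s₃ ⟨⟨c5, cR, c6, c4⟩, c3⟩
      rw [m3] at c4
      refine (Runs.of_loopFree (by simp [LoopFree]) ?_).mono (by simp [cost, NExp.cost, NExp.var])
        fun _ h => h
      refine ⟨by simp [run, NExp.eval, c6, two_mul], by simp [run, c3, m3],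
        by simp [run, cR, bR, aR], ?_, ?_⟩
      · rw [← aR]
        refine hI.sorted.congr fun u hu => ?_
        simp [run, c4 u hu]
      · refine hI.onto.congr fun u hu => ?_
        simp [run, c4 u hu]
    · rw [m3]
      simp only [cost, NExp.cost, NExp.var]
      omega
  · rw [n3]
    simp only [mergeStep, mergeTake, keyTest, cost, Test.cost, RExp.cost, NExp.cost, NExp.var]
    omega

/-- After `k` passes the blocks have length `2 ^ k`. The loop ends when a single block covers
everything, after at most `Nat.clog 2 N` linear passes. -/
theorem sort_runs (s : State) :
    Runs sort s (400 * ((s.nat 3 0 + 1) * (Nat.clog 2 (s.nat 3 0) + 1))) fun s' =>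
      Onto (s.nat 3 0) (s'.nat 4) ∧
      ∀ u v, u ≤ v → v < s.nat 3 0 → KeyLE (s.real 2) (s'.nat 4 u) (s'.nat 4 v) := by
  obtain ⟨N, hN⟩ : ∃ N, N = s.nat 3 0 := ⟨_, rfl⟩
  rw [← hN]
  rw [sort]
  refine ((Runs.forRange (by decide) (by simp [LoopFree]) (by simp [KeepsNat])
    (by simp [KeepsNat]) (fun k s' => s'.real = s.real ∧ ∀ u < k, s'.nat 4 u = u) s
      ?_ ?_).keepNat (a := 3) (by simp [forRange, KeepsNat])).seq
        (U := 320 * ((N + 1) * (Nat.clog 2 N + 1))) ?_ |>.mono ?_ fun _ h => h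
  · exact ⟨rfl, by simp⟩
  · rintro k s' - h7 - ⟨aR, a4⟩
    refine ⟨by simpa [run] using aR, fun u hu => ?_⟩
    by_cases huk : u = k
    · simp [run, h7, huk]
    · simp [run, h7, huk, a4 u (by omega)]
  · rintro s₁ ⟨⟨aR, a4⟩, a3⟩
    rw [← hN] at a4
    refine ((Runs.of_loopFree (Q := fun s' => s'.nat 3 0 = N ∧ s'.real 2 = s.real 2 ∧
      s'.nat 6 0 = 1 ∧ ∀ u < N, s'.nat 4 u = u) (by simp [LoopFree]) ?_).seq
      (U := 310 * ((N + 1) * (Nat.clog 2 N + 1))) ?_).mono ?_ fun _ h => h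
    · refine ⟨by simp [run, a3, hN], by simp [run, aR], by simp [run, NExp.eval], fun u hu => ?_⟩
      simp [run, a4 u hu]
    · rintro s₂ ⟨b3, bR, b6, b4⟩
      refine (Runs.loop (c := 300 * (N + 1)) (fun k s' => s'.nat 6 0 = 2 ^ k ∧ s'.nat 3 0 = N ∧
        s'.real 2 = s.real 2 ∧ BlockSorted (s.real 2) (2 ^ k) N (s'.nat 4) ∧
        Onto N (s'.nat 4)) (m := Nat.clog 2 N) ?_ (Nat.clog 2 N) 0 s₂ (by simp) ?_).mono ?_ ?_
      · rintro k s' ⟨c6, c3, cR, cs, cσ⟩ hb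
        have hlt : 2 ^ k < N := by
          simpa [Test.holds, NExp.eval, c6, c3, Nat.succ_le_iff] using hb
        refine ⟨(Nat.lt_clog_iff_pow_lt (by norm_num)).2 hlt, ?_⟩
        rw [← cR] at cs
        refine (mergePass_runs (by positivity) c6 cs cσ c3).mono le_rfl ?_
        rintro s'' ⟨d6, d3, dR, ds, dσ⟩
        rw [pow_succ']
        refine ⟨d6, d3, dR.trans cR, ?_, dσ⟩
        rwa [← cR]
      · have hid : Onto N (s₂.nat 4) :=
          ⟨fun u hu => by rwa [b4 u hu], fun x hx => ⟨x, hx, b4 x hx⟩⟩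
        refine ⟨b6, b3, bR, fun u v huv hv hd => ?_, hid⟩
        simp only [pow_zero, Nat.div_one] at hd
        rw [hd]
        exact KeyLE.refl _ _
      · simp only [Test.cost, NExp.cost, NExp.var]
        generalize Nat.clog 2 N = m
        ring_nf
        omega
      · rintro s' ⟨hb, k, -, c6, c3, -, cs, cσ⟩
        have hle : N ≤ 2 ^ k := by
          simpa [Test.holds, NExp.eval, c6, c3] using hb
        refine ⟨cσ, fun u v huv hv => cs u v huv hv ?_⟩
        rw [Nat.div_eq_of_lt (by omega), Nat.div_eq_of_lt (by omega)]
    · simp only [cost, NExp.cost]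
      generalize Nat.clog 2 N = m
      ring_nf
      omega
  · rw [← hN]
    simp only [cost, NExp.cost, NExp.var]
    nlinarith [Nat.zero_le (Nat.clog 2 N)]

end RealRAM

/-! ### Prefix minima in key order -/

namespace RealRAM

/-- The scalar variable stored in the array `a` of real numbers. -/
def RExp.var (a : ℕ) : RExp := .get a (.const 0)

@[simp]
theorem RExp.eval_var (s : State) (a : ℕ) : (RExp.var a).eval s = s.real a 0 := rfl

open Program

namespace Program

/-- Update the running minimum in the variable `5` by the value of the next index in sorted order,
and store it. -/
def prefixMinStep : Program :=
  .seq
    (.ite (.leReal (.get 3 (.get 4 (.var 7))) (.var 5))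
      (.setReal 5 (.const 0) (.get 3 (.get 4 (.var 7)))) .skip)
    (.setReal 4 (.get 4 (.var 7)) (.var 5))

/-- For all indices below the value of the variable `3`, compute the minimum of the values (in the
real array `3`) of the indices with smaller keys (in the real array `2`), and store it in the real
array `4`. -/
def prefixMin : Program :=
  .seq sort
    (.seq (.setReal 5 (.const 0) (.get 3 (.get 4 (.const 0))))
      (.forRange 7 3 prefixMinStep))

end Program

theorem prefixMinStep_run (s : State) :
    (prefixMinStep.run s).real 5 0 =
        min (s.real 3 (s.nat 4 (s.nat 7 0))) (s.real 5 0) ∧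
      ∀ v, (prefixMinStep.run s).real 4 v =
        if v = s.nat 4 (s.nat 7 0) then min (s.real 3 (s.nat 4 (s.nat 7 0))) (s.real 5 0)
        else s.real 4 v := by
  classical
  by_cases h : s.real 3 (s.nat 4 (s.nat 7 0)) ≤ s.real 5 0
  · simp [prefixMinStep, run, Test.holds, RExp.eval, NExp.eval, h]
  · simp [prefixMinStep, run, Test.holds, RExp.eval, NExp.eval, h, (not_le.1 h).le]

/-- The sorted positions up to that of `v` hold exactly the indices preceding `v` in the key order,
`v` included. The running minimum is filed under the index `v`, not under its position, so it can be
read without inverting the permutation. -/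
theorem prefixMin_runs (s : State) :
    Runs prefixMin s (500 * ((s.nat 3 0 + 1) * (Nat.clog 2 (s.nat 3 0) + 1))) fun s' =>
      ∀ v < s.nat 3 0,
        IsLeast (s.real 3 '' {u | u < s.nat 3 0 ∧ KeyLE (s.real 2) u v}) (s'.real 4 v) := by
  obtain ⟨N, hN⟩ : ∃ N, N = s.nat 3 0 := ⟨_, rfl⟩
  have hs := sort_runs s
  rw [← hN] at hs ⊢
  rw [prefixMin]
  refine ((hs.keepNat (a := 3) ?_).keepReal (a := 3) ?_).seq
    (U := 90 * (N + 1)) ?_ |>.mono ?_ fun _ h => h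
  · simp [sort, mergePass, mergeStep, mergeTake, forRange, KeepsNat]
  · simp [sort, mergePass, mergeStep, mergeTake, forRange, KeepsReal]
  rotate_left
  · generalize Nat.clog 2 N = m
    ring_nf
    omega
  rintro s₁ ⟨⟨⟨hσ, hsort⟩, a3⟩, aR⟩
  have n3 : s₁.nat 3 0 = N := by rw [a3, hN]
  refine ((Runs.of_loopFree (Q := fun s' => s'.nat = s₁.nat ∧ s'.real 3 = s.real 3 ∧
    s'.real 5 0 = s.real 3 (s₁.nat 4 0)) (by simp [LoopFree]) ?_).seq
    (U := 80 * (N + 1)) ?_).mono ?_ fun _ h => h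
  · refine ⟨by simp [run], by rw [← aR]; simp [run, funext_iff], ?_⟩
    simp [run, NExp.eval, RExp.eval, aR]
  · rintro s₂ ⟨b, bR, b5⟩
    have m3 : s₂.nat 3 0 = N := by rw [b, n3]
    have hf : prefixMinStep.LoopFree := by simp [prefixMinStep, LoopFree]
    have inv := Runs.forRange (i := 7) (b := 3) (body := prefixMinStep) (by decide) hf
      (by simp [prefixMinStep, KeepsNat]) (by simp [prefixMinStep, KeepsNat])
      (fun k s' => s'.nat 4 = s₁.nat 4 ∧ s'.real 3 = s.real 3 ∧
        IsLeast ((s.real 3 ∘ s₁.nat 4) '' Set.Iic (k - 1)) (s'.real 5 0) ∧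
        ∀ u < k, IsLeast ((s.real 3 ∘ s₁.nat 4) '' Set.Iic u) (s'.real 4 (s₁.nat 4 u))) s₂ ?_ ?_
    · rw [m3] at inv
      refine inv.mono ?_ ?_
      · simp only [prefixMinStep, cost, NExp.cost, RExp.cost, NExp.var, RExp.var, Test.cost]
        omega
      · rintro s' ⟨-, -, -, h⟩ v hv
        obtain ⟨u, hu, rfl⟩ := hσ.2 v hv
        convert h u hu using 1
        rw [Set.image_comp]
        congr 1
        ext x
        simp only [Set.mem_ofPred_eq, Set.mem_image, Set.mem_Iic]
        constructor
        · rintro ⟨hx, hle⟩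
          obtain ⟨y, hy, rfl⟩ := hσ.2 x hx
          refine ⟨y, ?_, rfl⟩
          by_contra! hlt
          have := hσ.injective hy hu (hle.antisymm (hsort u y hlt.le hy))
          omega
        · rintro ⟨y, hy, rfl⟩
          exact ⟨hσ.1 y (by omega), hsort y u hy hu⟩
    · refine ⟨by simp [funext_iff, b], by simp [bR], ?_, by simp⟩
      -- The running minimum starts with the entry at position 0. Truncated subtraction makes the
      -- invariant say just this for `k = 0`, and the first step inserts that entry again.
      have : Set.Iic (0 - 1) = {0} := by ext; simp
      rw [this, Set.image_singleton]
      simp [b5, isLeast_singleton]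
    · rintro k s' hk h7 - ⟨c4, cR, c5, cM⟩
      rw [m3] at hk
      obtain ⟨e5, eM⟩ := prefixMinStep_run s'
      rw [c4, h7, cR] at e5 eM
      have hmin : IsLeast ((s.real 3 ∘ s₁.nat 4) '' Set.Iic k)
          (min (s.real 3 (s₁.nat 4 k)) (s'.real 5 0)) := by
        have : Set.Iic k = insert k (Set.Iic (k - 1)) := by
          ext x; simp only [Set.mem_Iic, Set.mem_insert_iff]; omega
        rw [this, Set.image_insert_eq]
        exact c5.insert _
      refine ⟨?_, ?_, ?_, fun u hu => ?_⟩
      · rw [← c4, ← hf.nat_run (a := 4) (by simp [prefixMinStep, KeepsNat]) s']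
        simp [funext_iff]
      · rw [← cR, ← hf.real_run (a := 3) (by simp [prefixMinStep, KeepsReal]) s']
        rfl
      · simpa [e5] using hmin
      · rw [State.real_writeNat, eM]
        rcases Nat.lt_succ_iff_lt_or_eq.1 hu with hu | rfl
        · rw [if_neg]
          · exact cM u hu
          · intro h
            have := hσ.injective (by omega) (by omega) h
            omega
        · rw [if_pos rfl]
          exact hmin
  · simp only [cost, NExp.cost, RExp.cost]
    omega

end RealRAM

theorem IsLeast.image_le_iff {α : Type*} {f : α → ℝ} {S : Set α} {m : ℝ} (h : IsLeast (f '' S) m)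
    (r : ℝ) : m ≤ r ↔ ∃ u ∈ S, f u ≤ r := by
  constructor
  · intro hr
    obtain ⟨u, hu, rfl⟩ := h.1
    exact ⟨u, hu, hr⟩
  · rintro ⟨u, hu, hr⟩
    exact (h.2 ⟨u, hu, rfl⟩).trans hr

theorem IsLeast.image_lt_iff {α : Type*} {f : α → ℝ} {S : Set α} {m : ℝ} (h : IsLeast (f '' S) m)
    (r : ℝ) : m < r ↔ ∃ u ∈ S, f u < r := by
  constructor
  · intro hr
    obtain ⟨u, hu, rfl⟩ := h.1
    exact ⟨u, hu, hr⟩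
  · rintro ⟨u, hu, hr⟩
    exact (h.2 ⟨u, hu, rfl⟩).trans_lt hr

/-! ### Least heights of near points, quadrant by quadrant -/

namespace UnitSquare

/-- Among the points in the quadrant given by the signs `-σ` and `τ` there is one at height at most
`r` that is near the point `c`, provided that `c` is on the opposite side. -/
def Near (σ τ : ℝ) (X Y : ℕ → ℝ) (n c : ℕ) (r : ℝ) : Prop :=
  ∃ p < n, σ * X p ≤ 0 ∧ 0 ≤ τ * Y p ∧ σ * X c - 1 ≤ σ * X p ∧ τ * Y p ≤ 1 + τ * Y c ∧ τ * Y p ≤ r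

/-- The function `F` gives the least heights of points near the given ones. -/
def IsNear (σ τ : ℝ) (X Y : ℕ → ℝ) (n : ℕ) (F : ℕ → ℝ) : Prop :=
  ∀ c < n, ∀ r ≤ 1, F c ≤ r ↔ Near σ τ X Y n c r

/-- The points `a` and `b`, in opposite halves and in vertical position given by the signs `τ` and
`τ'`, have no common neighbour. -/
def BadPair (τ τ' : ℝ) (X Y : ℕ → ℝ) (n a b : ℕ) : Prop :=
  X a ≤ 0 ∧ 0 ≤ τ * Y a ∧ 0 ≤ X b ∧ 0 ≤ τ' * Y b ∧ τ' * Y b ≤ 1 ∧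
    ¬ Near (-1) τ' X Y n a 1 ∧ ¬ Near 1 (-τ) X Y n b (1 - τ * Y a) ∧
    ¬ Near 1 τ X Y n b 1 ∧ ¬ Near (-1) (-τ') X Y n a (1 - τ' * Y b)

end UnitSquare

open UnitSquare

namespace RealRAM

open Program

/-- The running time of sorting two arrays of length `n`, up to a constant factor. -/
def sortTime (n : ℕ) : ℕ :=
  (n + n + 1) * (Nat.clog 2 (n + n) + 1)

theorem succ_le_sortTime (n : ℕ) : n + 1 ≤ sortTime n := by
  unfold sortTime
  generalize Nat.clog 2 (n + n) = m
  ring_nf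
  omega

theorem prefixMin_keepsNat {a : ℕ} (h : a < 3) : prefixMin.KeepsNat a := by
  simp [prefixMin, prefixMinStep, sort, mergePass, mergeStep, mergeTake, forRange, KeepsNat]
  omega

theorem prefixMin_keepsReal {a : ℕ} (h : a ≠ 4 ∧ a ≠ 5) : prefixMin.KeepsReal a := by
  simp [prefixMin, prefixMinStep, sort, mergePass, mergeStep, mergeTake, forRange, KeepsReal]
  omega

namespace Program

/-- Prepare the computation of the least heights: the points and then the queries. -/
def nearInit (σ τ : ℚ) (x y : ℕ) : Program :=
  .seq (.setReal 2 (.var 2) (.mul (.const (-σ)) (.get x (.var 2))))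
    (.seq (.setReal 2 (.add (.var 1) (.var 2))
        (.sub (.const 1) (.mul (.const σ) (.get x (.var 2)))))
      (.seq
        (.ite (.and (.leReal (.mul (.const σ) (.get x (.var 2))) (.const 0))
            (.leReal (.const 0) (.mul (.const τ) (.get y (.var 2)))))
          (.setReal 3 (.var 2) (.mul (.const τ) (.get y (.var 2))))
          (.setReal 3 (.var 2) (.const 3)))
        (.setReal 3 (.add (.var 1) (.var 2)) (.const 3))))

/-- Read off the result of the computation of the least heights. -/
def nearRead (τ : ℚ) (y f : ℕ) : Program :=
  .ite (.leReal (.get 4 (.add (.var 1) (.var 2)))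
      (.add (.const 1) (.mul (.const τ) (.get y (.var 2)))))
    (.setReal f (.var 2) (.get 4 (.add (.var 1) (.var 2))))
    (.setReal f (.var 2) (.const 3))

/-- Compute the least heights of points near the given ones, and store them in the array `f`. -/
def near (σ τ : ℚ) (x y f : ℕ) : Program :=
  .seq (.setNat 3 (.const 0) (.add (.var 1) (.var 1)))
    (.seq (.forRange 2 1 (nearInit σ τ x y))
      (.seq prefixMin (.forRange 2 1 (nearRead τ y f))))

end Program

theorem nearInit_run {σ τ : ℚ} {x y : ℕ} (hx : x < 2) (hy : y < 2) (s : State) (v : ℕ) :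
    ((nearInit σ τ x y).run s).real 2 v = (if v = s.nat 1 0 + s.nat 2 0 then
        1 - σ * s.real x (s.nat 2 0) else if v = s.nat 2 0 then
        - (σ * s.real x (s.nat 2 0)) else s.real 2 v) ∧
    ((nearInit σ τ x y).run s).real 3 v = (if v = s.nat 1 0 + s.nat 2 0 then 3 else
      if v = s.nat 2 0 then
        if σ * s.real x (s.nat 2 0) ≤ 0 ∧ 0 ≤ τ * s.real y (s.nat 2 0) then
          τ * s.real y (s.nat 2 0) else 3
      else s.real 3 v) := by
  classical
  have hx2 : x ≠ 2 := by omega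
  have hy2 : y ≠ 2 := by omega
  have hx3 : x ≠ 3 := by omega
  have hy3 : y ≠ 3 := by omega
  by_cases h : σ * s.real x (s.nat 2 0) ≤ 0 ∧ 0 ≤ τ * s.real y (s.nat 2 0)
  · simp [nearInit, run, Test.holds, RExp.eval, NExp.eval, hx2, hy2, h]
  · simp [nearInit, run, Test.holds, RExp.eval, NExp.eval, hx2, hy2, h]

/-- The keys turn the horizontal condition into precedence; a tie counts as success because points
have smaller indices than queries. The bound `1 + τ * Y c` restricts the very quantity that is
minimised, so it suffices to test it on the minimum. The value 3 stands for infinity, since every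
threshold `r` is at most 1. -/
theorem near_spec {σ τ : ℝ} {X Y K V M F : ℕ → ℝ} {n : ℕ}
    (hK : ∀ u < n, K u = - (σ * X u) ∧ K (n + u) = 1 - σ * X u)
    (hV : ∀ u < n, V u = (if σ * X u ≤ 0 ∧ 0 ≤ τ * Y u then τ * Y u else 3) ∧ V (n + u) = 3)
    (hM : ∀ v < n + n, IsLeast (V '' {u | u < n + n ∧ KeyLE K u v}) (M v))
    (hF : ∀ u < n, F u = if M (n + u) ≤ 1 + τ * Y u then M (n + u) else 3) :
    IsNear σ τ X Y n F := by
  intro c hc r hr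
  have key : F c ≤ r ↔ M (n + c) ≤ min (1 + τ * Y c) r := by
    rw [hF c hc, le_min_iff]
    split_ifs with h
    · simp [h]
    · simp only [h, false_and, iff_false]
      linarith
  rw [key, (hM (n + c) (by omega)).image_le_iff]
  constructor
  · rintro ⟨u, ⟨hu, hle, -⟩, hV'⟩
    have hV1 := hV'.trans (min_le_left _ _)
    have hV2 := hV'.trans (min_le_right _ _)
    by_cases hun : u < n
    · rw [(hK u hun).1, (hK c hc).2] at hle
      rw [(hV u hun).1] at hV1 hV2
      split_ifs at hV1 hV2 with h
      · exact ⟨u, hun, h.1, h.2, by linarith, hV1, hV2⟩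
      · linarith
    · obtain ⟨w, rfl⟩ := Nat.exists_eq_add_of_le (not_lt.1 hun)
      rw [(hV w (by omega)).2] at hV2
      linarith
  · rintro ⟨p, hp, h1, h2, h3, h4, h5⟩
    refine ⟨p, ⟨by omega, ?_, fun _ => by omega⟩, ?_⟩
    · rw [(hK p hp).1, (hK c hc).2]
      linarith
    · rw [(hV p hp).1, if_pos ⟨h1, h2⟩]
      exact le_min h4 h5

theorem near_runs {σ τ : ℚ} {x y f : ℕ} (hx : x < 2) (hy : y < 2) (hf : 5 < f) (s : State) :
    Runs (near σ τ x y f) s (900 * sortTime (s.nat 1 0)) fun s' =>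
      IsNear σ τ (s.real x) (s.real y) (s.nat 1 0) (s'.real f) := by
  classical
  obtain ⟨n, hn⟩ : ∃ n, n = s.nat 1 0 := ⟨_, rfl⟩
  rw [← hn, near]
  refine ((Runs.of_loopFree (Q := fun s' => s'.nat 3 0 = n + n ∧ s'.nat 1 0 = n ∧
    s'.real = s.real) (by simp [LoopFree]) ?_).seq (U := 890 * sortTime n) ?_).mono ?_ fun _ h => h
  · simp [run, NExp.eval, hn]
  rotate_left
  · have := succ_le_sortTime n
    simp only [cost, NExp.cost, NExp.var]
    omega
  rintro s₁ ⟨a3, a1, aR⟩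
  refine ((Runs.forRange (by decide) (by simp [nearInit, LoopFree])
    (by simp [nearInit, KeepsNat]) (by simp [nearInit, KeepsNat])
    (fun k s' => s'.nat 3 0 = n + n ∧ s'.real x = s.real x ∧ s'.real y = s.real y ∧ ∀ u < k,
      (s'.real 2 u = - (σ * s.real x u) ∧ s'.real 2 (n + u) = 1 - σ * s.real x u) ∧
      s'.real 3 u = (if σ * s.real x u ≤ 0 ∧ 0 ≤ τ * s.real y u then τ * s.real y u else 3) ∧
      s'.real 3 (n + u) = 3) s₁ ?_ ?_).keepNat (a := 1)
        (by simp [nearInit, forRange, KeepsNat])).seq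
    (U := 700 * sortTime n) ?_ |>.mono ?_ fun _ h => h
  · simp [a3, aR]
  · rintro k s' hk h2 h1 ⟨b3, bx, byy, bu⟩
    rw [a1] at h1 hk
    have hlf : (nearInit σ τ x y).LoopFree := by simp [nearInit, LoopFree]
    refine ⟨?_, ?_, ?_, fun u hu => ?_⟩
    · rw [← b3]
      simp [hlf.nat_run (a := 3) (by simp [nearInit, KeepsNat])]
    · rw [← bx]
      exact hlf.real_run (by simp only [nearInit, KeepsReal]; omega) s'
    · rw [← byy]
      exact hlf.real_run (by simp only [nearInit, KeepsReal]; omega) s'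
    · have e := nearInit_run (σ := σ) (τ := τ) hx hy s'
      rw [h1, h2, bx, byy] at e
      simp only [State.real_writeNat, (e _).1, (e _).2]
      by_cases huk : u = k
      · subst huk
        -- Inside the loop `n` is positive, so the cells `u` and `n + u` are distinct.
        simp [show n ≠ 0 by omega]
      · simp only [show u ≠ n + k by omega, show n + u ≠ n + k by omega, show n + u ≠ k by omega,
          huk, if_false]
        exact bu u (by omega)
  · rintro s₂ ⟨⟨b3, bx, byy, bu⟩, b1⟩
    rw [a1] at bu
    have b1' : s₂.nat 1 0 = n := by rw [b1, a1]
    have hM := prefixMin_runs s₂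
    rw [b3] at hM
    refine ((((hM.keepNat (prefixMin_keepsNat (a := 1) (by decide))).keepReal
      (prefixMin_keepsReal (a := x) (by omega))).keepReal
      (prefixMin_keepsReal (a := y) (by omega))).seq
      (U := 100 * sortTime n) ?_).mono ?_ fun _ h => h
    · rintro s₃ ⟨⟨⟨cM, c1⟩, cx⟩, cy⟩
      have c1' : s₃.nat 1 0 = n := by rw [c1, b1']
      have inv := Runs.forRange (i := 2) (b := 1) (body := nearRead τ y f) (by decide)
        (by simp [nearRead, LoopFree]) (by simp [nearRead, KeepsNat]) (by simp [nearRead, KeepsNat])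
        (fun k s' => s'.real 4 = s₃.real 4 ∧ s'.real y = s.real y ∧ ∀ u < k, s'.real f u =
          if s₃.real 4 (n + u) ≤ 1 + τ * s.real y u then s₃.real 4 (n + u) else 3) s₃ ?_ ?_
      · rw [c1'] at inv
        refine inv.mono ?_ ?_
        · have := succ_le_sortTime n
          simp only [nearRead, cost, NExp.cost, RExp.cost, NExp.var, Test.cost]
          omega
        · rintro s' ⟨-, -, h⟩
          exact near_spec (fun u hu => (bu u hu).1) (fun u hu => (bu u hu).2) cM h
      · simp [cy, byy]
      · rintro k s' hk h2 h1 ⟨d4, dy, dF⟩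
        rw [c1'] at h1
        have hlf : (nearRead τ y f).LoopFree := by simp [nearRead, LoopFree]
        refine ⟨?_, ?_, fun u hu => ?_⟩
        · rw [← d4]
          exact hlf.real_run (by simp only [nearRead, KeepsReal]; omega) s'
        · rw [← dy]
          exact hlf.real_run (by simp only [nearRead, KeepsReal]; omega) s'
        · by_cases hc : s₃.real 4 (n + k) ≤ 1 + τ * s.real y k
          · have e : (nearRead τ y f).run s' = s'.writeReal f k (s₃.real 4 (n + k)) := by
              simp [nearRead, run, Test.holds, RExp.eval, NExp.eval, h1, h2, d4, dy, hc]
            by_cases huk : u = k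
            · simp [e, huk, hc]
            · simp [e, huk, dF u (by omega)]
          · have e : (nearRead τ y f).run s' = s'.writeReal f k 3 := by
              simp [nearRead, run, Test.holds, RExp.eval, NExp.eval, h1, h2, d4, dy, hc]
            by_cases huk : u = k
            · simp [e, huk, hc]
            · simp [e, huk, dF u (by omega)]
    · rw [← sortTime]
      omega
  · have := succ_le_sortTime n
    rw [a1]
    simp only [nearInit, cost, NExp.cost, RExp.cost, NExp.var, Test.cost]
    omega

end RealRAM

/-! ### The search for bad pairs -/

open UnitSquare

namespace RealRAM

open Program

namespace Program

/-- Prepare the search for bad pairs: the right points as queries and then the left points. -/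
def pairInit (τ : ℚ) (x y f₁ f₂ g₂ : ℕ) : Program :=
  .seq (.setReal 2 (.var 2) (.get g₂ (.var 2)))
    (.seq (.setReal 2 (.add (.var 1) (.var 2))
        (.sub (.const 1) (.mul (.const τ) (.get y (.var 2)))))
      (.seq (.setReal 3 (.var 2) (.const 3))
        (.ite (.and (.leReal (.get x (.var 2)) (.const 0))
            (.and (.leReal (.const 0) (.mul (.const τ) (.get y (.var 2))))
              (.not (.leReal (.get f₁ (.var 2)) (.const 1)))))
          (.setReal 3 (.add (.var 1) (.var 2)) (.sub (.const 0) (.get f₂ (.var 2))))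
          (.setReal 3 (.add (.var 1) (.var 2)) (.const 3)))))

/-- Set the answer to zero if the right point under consideration belongs to a bad pair. -/
def pairRead (τ : ℚ) (x y g₁ : ℕ) : Program :=
  .ite (.and (.leReal (.const 0) (.get x (.var 2)))
      (.and (.leReal (.const 0) (.mul (.const τ) (.get y (.var 2))))
        (.and (.leReal (.mul (.const τ) (.get y (.var 2))) (.const 1))
          (.and (.not (.leReal (.get g₁ (.var 2)) (.const 1)))
            (.not (.leReal (.sub (.mul (.const τ) (.get y (.var 2))) (.const 1))
              (.get 4 (.var 2))))))))
    (.setNat 0 (.const 0) (.const 0)) .skip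

/-- Set the answer to zero if there is a bad pair. -/
def pairs (τ τ' : ℚ) (x y f₁ f₂ g₁ g₂ : ℕ) : Program :=
  .seq (.setNat 3 (.const 0) (.add (.var 1) (.var 1)))
    (.seq (.forRange 2 1 (pairInit τ x y f₁ f₂ g₂))
      (.seq prefixMin (.forRange 2 1 (pairRead τ' x y g₁))))

end Program

theorem pairInit_run {τ : ℚ} {x y f₁ f₂ g₂ : ℕ} (hx : x < 2) (hy : y < 2) (hf₁ : 5 < f₁)
    (hf₂ : 5 < f₂) (s : State) (v : ℕ) :
    ((pairInit τ x y f₁ f₂ g₂).run s).real 2 v = (if v = s.nat 1 0 + s.nat 2 0 then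
        1 - τ * s.real y (s.nat 2 0) else if v = s.nat 2 0 then
        s.real g₂ (s.nat 2 0) else s.real 2 v) ∧
    ((pairInit τ x y f₁ f₂ g₂).run s).real 3 v = (if v = s.nat 1 0 + s.nat 2 0 then
        if s.real x (s.nat 2 0) ≤ 0 ∧ 0 ≤ τ * s.real y (s.nat 2 0) ∧
          ¬ s.real f₁ (s.nat 2 0) ≤ 1 then - s.real f₂ (s.nat 2 0) else 3
      else if v = s.nat 2 0 then 3
      else s.real 3 v) := by
  classical
  have hx2 : x ≠ 2 := by omega
  have hy2 : y ≠ 2 := by omega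
  have hx3 : x ≠ 3 := by omega
  have hy3 : y ≠ 3 := by omega
  have h1 : f₁ ≠ 2 := by omega
  have h2 : f₂ ≠ 2 := by omega
  have h3 : f₁ ≠ 3 := by omega
  have h4 : f₂ ≠ 3 := by omega
  by_cases h : s.real x (s.nat 2 0) ≤ 0 ∧ 0 ≤ τ * s.real y (s.nat 2 0) ∧
      ¬ s.real f₁ (s.nat 2 0) ≤ 1
  · simp only [pairInit, run, Test.holds, RExp.eval, NExp.eval, NExp.eval_var, State.real_writeReal,
      State.nat_writeReal, hx2, hy2, hx3, hy3, h1, h2, h3, h4, false_and, if_false, Rat.cast_zero,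
      Rat.cast_one, Rat.cast_ofNat, h, zero_sub, if_true, true_and, and_true, and_self,
      not_false_eq_true]
    simp
  · simp only [pairInit, run, Test.holds, RExp.eval, NExp.eval, NExp.eval_var, State.real_writeReal,
      State.nat_writeReal, hx2, hy2, hx3, hy3, h1, h2, h3, h4, false_and, if_false, Rat.cast_zero,
      Rat.cast_one, Rat.cast_ofNat, h]
    simp

/-- The conditions that couple `a` and `b` are `1 - τ * Y a < G₂ b` and `1 - τ' * Y b < F₂ a`. The
first is precedence of `n + a` before `b`; it is strict because queries now have the smaller indices
and win ties. The second asks for a large `F₂ a`, whence the minimum of `-F₂`. The filler 3 cannot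
count, as `τ' * Y b - 1 ≤ 0`. -/
theorem exists_badPair_iff {τ τ' : ℝ} {X Y K V M F₁ F₂ G₁ G₂ : ℕ → ℝ} {n : ℕ}
    (hF₁ : IsNear (-1) τ' X Y n F₁) (hF₂ : IsNear (-1) (-τ') X Y n F₂)
    (hG₁ : IsNear 1 τ X Y n G₁) (hG₂ : IsNear 1 (-τ) X Y n G₂)
    (hK : ∀ u < n, K u = G₂ u ∧ K (n + u) = 1 - τ * Y u)
    (hV : ∀ u < n, V u = 3 ∧
      V (n + u) = if X u ≤ 0 ∧ 0 ≤ τ * Y u ∧ ¬ F₁ u ≤ 1 then - F₂ u else 3)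
    (hM : ∀ v < n + n, IsLeast (V '' {u | u < n + n ∧ KeyLE K u v}) (M v)) {b : ℕ} (hb : b < n) :
    (∃ a < n, BadPair τ τ' X Y n a b) ↔ 0 ≤ X b ∧ 0 ≤ τ' * Y b ∧ τ' * Y b ≤ 1 ∧ ¬ G₁ b ≤ 1 ∧
      ¬ τ' * Y b - 1 ≤ M b := by
  rw [hG₁ b hb 1 le_rfl, not_le, (hM b (by omega)).image_lt_iff]
  constructor
  · rintro ⟨a, ha, h1, h2, h3, h4, h5, h6, h7, h8, h9⟩
    refine ⟨h3, h4, h5, h8, n + a, ⟨by omega, ?_⟩, ?_⟩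
    · rw [← hG₂ b hb _ (by linarith)] at h7
      unfold KeyLE
      rw [(hK a ha).2, (hK b hb).1]
      exact ⟨(not_le.1 h7).le, fun h => absurd h h7⟩
    · rw [← hF₁ a ha 1 le_rfl] at h6
      rw [← hF₂ a ha _ (by linarith)] at h9
      rw [(hV a ha).2, if_pos ⟨h1, h2, h6⟩]
      linarith
  · rintro ⟨h3, h4, h5, h8, u, ⟨hu, hle⟩, hlt⟩
    by_cases hun : u < n
    · rw [(hV u hun).1] at hlt
      linarith
    · obtain ⟨a, rfl⟩ := Nat.exists_eq_add_of_le (not_lt.1 hun)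
      have ha : a < n := by omega
      rw [(hV a ha).2] at hlt
      split_ifs at hlt with h
      · refine ⟨a, ha, h.1, h.2.1, h3, h4, h5, ?_, ?_, h8, ?_⟩
        · rw [← hF₁ a ha 1 le_rfl]
          exact h.2.2
        · rw [← hG₂ b hb _ (by linarith)]
          intro hle'
          rw [← (hK a ha).2, ← (hK b hb).1] at hle'
          have := hle.2 hle'
          omega
        · rw [← hF₂ a ha _ (by linarith)]
          linarith
      · linarith

open Classical in
theorem pairs_runs {τ τ' : ℚ} {x y f₁ f₂ g₁ g₂ : ℕ} (hx : x < 2) (hy : y < 2) (hf₁ : 5 < f₁)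
    (hf₂ : 5 < f₂) (hg₁ : 5 < g₁) (hg₂ : 5 < g₂) (s : State)
    (hF₁ : IsNear (-1) τ' (s.real x) (s.real y) (s.nat 1 0) (s.real f₁))
    (hF₂ : IsNear (-1) (-τ') (s.real x) (s.real y) (s.nat 1 0) (s.real f₂))
    (hG₁ : IsNear 1 τ (s.real x) (s.real y) (s.nat 1 0) (s.real g₁))
    (hG₂ : IsNear 1 (-τ) (s.real x) (s.real y) (s.nat 1 0) (s.real g₂)) :
    Runs (pairs τ τ' x y f₁ f₂ g₁ g₂) s (900 * sortTime (s.nat 1 0)) fun s' =>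
      s'.nat 0 0 = if ∃ b < s.nat 1 0, ∃ a < s.nat 1 0,
        BadPair τ τ' (s.real x) (s.real y) (s.nat 1 0) a b then 0 else s.nat 0 0 := by
  obtain ⟨n, hn⟩ : ∃ n, n = s.nat 1 0 := ⟨_, rfl⟩
  rw [← hn] at hF₁ hF₂ hG₁ hG₂ ⊢
  rw [pairs]
  refine ((Runs.of_loopFree (Q := fun s' => s'.nat 3 0 = n + n ∧ s'.nat 1 0 = n ∧
    s'.nat 0 0 = s.nat 0 0 ∧
    s'.real = s.real) (by simp [LoopFree]) ?_).seq (U := 890 * sortTime n) ?_).mono ?_ fun _ h => h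
  · simp [run, NExp.eval, hn]
  rotate_left
  · have := succ_le_sortTime n
    simp only [cost, NExp.cost, NExp.var]
    omega
  rintro s₁ ⟨a3, a1, a0, aR⟩
  have hlf : (pairInit τ x y f₁ f₂ g₂).LoopFree := by simp [pairInit, LoopFree]
  refine (((Runs.forRange (by decide) hlf
    (by simp [pairInit, KeepsNat]) (by simp [pairInit, KeepsNat])
    (fun k s' => s'.nat 3 0 = n + n ∧ (∀ d, d ≠ 2 → d ≠ 3 → s'.real d = s.real d) ∧ ∀ u < k,
      (s'.real 2 u = s.real g₂ u ∧ s'.real 2 (n + u) = 1 - τ * s.real y u) ∧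
      s'.real 3 u = 3 ∧ s'.real 3 (n + u) =
        if s.real x u ≤ 0 ∧ 0 ≤ τ * s.real y u ∧ ¬ s.real f₁ u ≤ 1 then - s.real f₂ u else 3)
      s₁ ?_ ?_).keepNat (a := 1)
        (by simp [pairInit, forRange, KeepsNat])).keepNat (a := 0)
        (by simp [pairInit, forRange, KeepsNat])).seq
    (U := 700 * sortTime n) ?_ |>.mono ?_ fun _ h => h
  · simp [a3, aR]
  · rintro k s' hk h2 h1 ⟨b3, bR, bu⟩
    rw [a1] at h1 hk
    refine ⟨?_, fun d d2 d3 => ?_, fun u hu => ?_⟩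
    · rw [← b3]
      simp [hlf.nat_run (a := 3) (by simp [pairInit, KeepsNat])]
    · rw [← bR d d2 d3]
      exact hlf.real_run (by simp only [pairInit, KeepsReal]; omega) s'
    · have e := pairInit_run (τ := τ) (f₁ := f₁) (f₂ := f₂) (g₂ := g₂) hx hy hf₁ hf₂ s'
      rw [h1, h2, bR x (by omega) (by omega), bR y (by omega) (by omega),
        bR f₁ (by omega) (by omega), bR f₂ (by omega) (by omega), bR g₂ (by omega) (by omega)] at e
      simp only [State.real_writeNat, (e _).1, (e _).2]
      by_cases huk : u = k
      · subst huk
        simp [show n ≠ 0 by omega]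
      · simp only [show u ≠ n + k by omega, show n + u ≠ n + k by omega, show n + u ≠ k by omega,
          huk, if_false]
        exact bu u (by omega)
  · rintro s₂ ⟨⟨⟨b3, bR, bu⟩, b1⟩, b0⟩
    rw [a1] at bu
    have b1' : s₂.nat 1 0 = n := by rw [b1, a1]
    have hM := prefixMin_runs s₂
    rw [b3] at hM
    refine ((((((hM.keepNat (prefixMin_keepsNat (a := 1) (by decide))).keepNat
      (prefixMin_keepsNat (a := 0) (by decide))).keepReal
      (prefixMin_keepsReal (a := x) (by omega))).keepReal
      (prefixMin_keepsReal (a := y) (by omega))).keepReal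
      (prefixMin_keepsReal (a := g₁) (by omega))).seq
      (U := 100 * sortTime n) ?_).mono ?_ fun _ h => h
    · rintro s₃ ⟨⟨⟨⟨⟨cM, c1⟩, c0⟩, cx⟩, cy⟩, cg⟩
      rw [bR x (by omega) (by omega)] at cx
      rw [bR y (by omega) (by omega)] at cy
      rw [bR g₁ (by omega) (by omega)] at cg
      have c1' : s₃.nat 1 0 = n := by rw [c1, b1']
      have c0' : s₃.nat 0 0 = s.nat 0 0 := by rw [c0, b0, a0]
      have bad := @exists_badPair_iff _ _ _ _ _ _ _ _ _ _ _ n hF₁ hF₂ hG₁ hG₂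
        (fun u hu => (bu u hu).1) (fun u hu => (bu u hu).2) cM
      have hlf' : (pairRead τ' x y g₁).LoopFree := by simp [pairRead, LoopFree]
      have inv := Runs.forRange (i := 2) (b := 1) (body := pairRead τ' x y g₁) (by decide)
        hlf' (by simp [pairRead, KeepsNat]) (by simp [pairRead, KeepsNat])
        (fun k s' => s'.real = s₃.real ∧ s'.nat 0 0 = if ∃ b < k, ∃ a < n,
          BadPair τ τ' (s.real x) (s.real y) n a b then 0 else s.nat 0 0) s₃ ?_ ?_
      · rw [c1'] at inv
        refine inv.mono ?_ fun s' h => h.2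
        have := succ_le_sortTime n
        simp only [pairRead, cost, NExp.cost, RExp.cost, NExp.var, Test.cost]
        omega
      · simp [c0']
      · rintro k s' hk h2 h1 ⟨dR, d0⟩
        rw [c1'] at h1 hk
        have hex : (∃ b < k + 1, ∃ a < n, BadPair τ τ' (s.real x) (s.real y) n a b) ↔
            (∃ b < k, ∃ a < n, BadPair τ τ' (s.real x) (s.real y) n a b) ∨
              ∃ a < n, BadPair τ τ' (s.real x) (s.real y) n a k := by
          constructor
          · rintro ⟨b, hb, h⟩
            rcases Nat.lt_succ_iff_lt_or_eq.1 hb with hb | rfl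
            · exact .inl ⟨b, hb, h⟩
            · exact .inr h
          · rintro (⟨b, hb, h⟩ | h)
            · exact ⟨b, by omega, h⟩
            · exact ⟨k, by omega, h⟩
        have hk' := bad hk
        refine ⟨?_, ?_⟩
        · rw [← dR]
          funext d
          exact hlf'.real_run (by simp [pairRead, KeepsReal]) s'
        · by_cases hc : ∃ a < n, BadPair τ τ' (s.real x) (s.real y) n a k
          · have e : (pairRead τ' x y g₁).run s' = s'.writeNat 0 0 0 := by
              rw [hk'] at hc
              simp only [pairRead, run, Test.holds, RExp.eval, NExp.eval, NExp.eval_var, h2, dR, cx,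
                cy, cg, Rat.cast_zero, Rat.cast_one, hc, if_true, not_false_eq_true, and_self]
            simp only [hex, hc, or_true, if_true]
            simp [e]
          · have e : (pairRead τ' x y g₁).run s' = s' := by
              rw [hk'] at hc
              simp only [pairRead, run, Test.holds, RExp.eval, NExp.eval, NExp.eval_var, h2, dR, cx,
                cy, cg, Rat.cast_zero, Rat.cast_one, hc, if_false]
            simp only [hex, hc, or_false]
            simp [e, d0]
    · rw [← sortTime]
      omega
  · have := succ_le_sortTime n
    rw [a1]
    simp only [pairInit, cost, NExp.cost, RExp.cost, NExp.var, Test.cost]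
    omega

/-! ### Normalising the coordinates -/

namespace Program

/-- Shift the coordinates in the array `x` so that the minimum becomes `-1`, and set the answer to
zero if the maximum becomes larger than `1`. -/
def centre (x : ℕ) : Program :=
  .seq (.setReal 6 (.const 0) (.get x (.const 0)))
    (.seq
      (.forRange 2 1 (.ite (.leReal (.get x (.var 2)) (.var 6))
        (.setReal 6 (.const 0) (.get x (.var 2))) .skip))
      (.forRange 2 1
        (.seq (.setReal x (.var 2) (.sub (.sub (.get x (.var 2)) (.var 6)) (.const 1)))
          (.ite (.leReal (.get x (.var 2)) (.const 1)) .skip (.setNat 0 (.const 0) (.const 0))))))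

end Program

open Classical in
theorem centre_runs {x : ℕ} (hx : x < 2) (s : State) :
    Runs (centre x) s (200 * sortTime (s.nat 1 0)) fun s' =>
      ∃ m, (∀ i < s.nat 1 0, m ≤ s.real x i ∧ s'.real x i = s.real x i - m - 1) ∧
        (0 < s.nat 1 0 → ∃ i < s.nat 1 0, s.real x i = m) ∧
        s'.nat 0 0 = if ∃ i < s.nat 1 0, 1 < s.real x i - m - 1 then 0 else s.nat 0 0 := by
  obtain ⟨n, hn⟩ : ∃ n, n = s.nat 1 0 := ⟨_, rfl⟩
  rw [← hn, centre]
  have hx6 : x ≠ 6 := by omega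
  refine ((Runs.of_loopFree (Q := fun s' => s'.nat = s.nat ∧ s'.real x = s.real x ∧
    s'.real 6 0 = s.real x 0) (by simp [LoopFree]) ?_).seq
    (U := 190 * sortTime n) ?_).mono ?_ fun _ h => h
  · simp [run, NExp.eval, RExp.eval, funext_iff, hx6]
  rotate_left
  · have := succ_le_sortTime n
    simp only [cost, NExp.cost, RExp.cost]
    omega
  rintro s₁ ⟨a, ax, a6⟩
  have a1 : s₁.nat 1 0 = n := by rw [a, hn]
  refine ((Runs.forRange (by decide) (by simp [LoopFree]) (by simp [KeepsNat]) (by simp [KeepsNat])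
    (fun k s' => s'.nat 0 0 = s.nat 0 0 ∧ s'.real x = s.real x ∧
      -- The minimum is initialised from cell 0 before any comparison, so at `k = 0` it is attained
      -- at index 0.
      (∃ i < max k 1, s.real x i = s'.real 6 0) ∧ ∀ i < k, s'.real 6 0 ≤ s.real x i)
    s₁ ?_ ?_).keepNat (a := 1) (by simp [forRange, KeepsNat])).seq
    (U := 100 * sortTime n) ?_ |>.mono ?_ fun _ h => h
  · simp [a, ax, a6]
  · rintro k s' hk h2 h1 ⟨b0, bx, ⟨i, hi, bi⟩, bm⟩
    by_cases hc : s.real x k ≤ s'.real 6 0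
    · simp only [run, Test.holds, RExp.eval, NExp.eval, NExp.eval_var, RExp.eval_var, h2, bx, hc,
        if_true]
      refine ⟨by simp [b0], by simp [funext_iff, bx, hx6], ⟨k, by simp, by simp⟩, fun i hi => ?_⟩
      simp only [State.real_writeNat, State.real_writeReal, and_self, if_true]
      rcases Nat.lt_succ_iff_lt_or_eq.1 hi with hi | rfl
      · exact hc.trans (bm i hi)
      · exact le_rfl
    · simp only [run, Test.holds, RExp.eval, NExp.eval, NExp.eval_var, RExp.eval_var, h2, bx, hc,
        if_false]
      refine ⟨by simp [b0], by simp [bx], ⟨i, by omega, by simp [bi]⟩, fun i hi => ?_⟩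
      simp only [State.real_writeNat]
      rcases Nat.lt_succ_iff_lt_or_eq.1 hi with hi | rfl
      · exact bm i hi
      · exact (not_le.1 hc).le
  · rintro s₂ ⟨⟨b0, bx, bi, bm⟩, b1⟩
    rw [a1] at bi bm
    have b1' : s₂.nat 1 0 = n := by rw [b1, a1]
    generalize hm : s₂.real 6 0 = m at bi bm
    have inv := Runs.forRange (i := 2) (b := 1) (body :=
        (.seq (.setReal x (.var 2) (.sub (.sub (.get x (.var 2)) (.var 6)) (.const 1)))
          (.ite (.leReal (.get x (.var 2)) (.const 1)) .skip (.setNat 0 (.const 0) (.const 0)))))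
        (by decide) (by simp [LoopFree]) (by simp [KeepsNat]) (by simp [KeepsNat])
        (fun k s' => s'.real 6 0 = m ∧ (∀ i < k, s'.real x i = s.real x i - m - 1) ∧
          (∀ i, k ≤ i → s'.real x i = s.real x i) ∧
          s'.nat 0 0 = if ∃ i < k, 1 < s.real x i - m - 1 then 0 else s.nat 0 0) s₂ ?_ ?_
    · rw [b1'] at inv
      refine inv.mono ?_ ?_
      · have := succ_le_sortTime n
        simp only [cost, NExp.cost, RExp.cost, NExp.var, RExp.var, Test.cost]
        omega
      · rintro s' ⟨-, h1, -, h0⟩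
        refine ⟨m, fun i hi => ⟨bm i hi, h1 i hi⟩, fun hpos => ?_, h0⟩
        rwa [max_eq_left (by omega)] at bi
    · simp [hm, bx, b0]
    · rintro k s' hk h2 h1 ⟨c6, cx, cx', c0⟩
      have hex : (∃ i < k + 1, 1 < s.real x i - m - 1) ↔
          (∃ i < k, 1 < s.real x i - m - 1) ∨ 1 < s.real x k - m - 1 := by
        constructor
        · rintro ⟨b, hb, h⟩
          rcases Nat.lt_succ_iff_lt_or_eq.1 hb with hb | rfl
          · exact .inl ⟨b, hb, h⟩
          · exact .inr h
        · rintro (⟨b, hb, h⟩ | h)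
          · exact ⟨b, by omega, h⟩
          · exact ⟨k, by omega, h⟩
      have w (i : ℕ) : (s'.writeReal x k (s.real x k - m - 1)).real x i =
          if i = k then s.real x k - m - 1 else s'.real x i := by simp
      by_cases hc : s.real x k - m - 1 ≤ 1
      · simp only [run, Test.holds, RExp.eval, NExp.eval, NExp.eval_var, RExp.eval_var,
          State.nat_writeReal, h2, c6, cx' k le_rfl, w, if_true, Rat.cast_one, hc, hex,
          not_lt.2 hc, or_false]
        refine ⟨by simp [hx6.symm, c6], fun i hi => ?_, fun i hi => ?_, by simp [c0]⟩
        · rw [State.real_writeNat, w]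
          split_ifs with h
          · rw [h]
          · exact cx i (by omega)
        · rw [State.real_writeNat, w, if_neg (by omega), cx' i (by omega)]
      · simp only [run, Test.holds, RExp.eval, NExp.eval, NExp.eval_var, RExp.eval_var,
          State.nat_writeReal, h2, c6, cx' k le_rfl, w, if_true, if_false, Rat.cast_one, hc, hex,
          not_le.1 hc, or_true]
        refine ⟨by simp [hx6.symm, c6], fun i hi => ?_, fun i hi => ?_, by simp⟩
        · rw [State.real_writeNat, State.real_writeNat, w]
          split_ifs with h
          · rw [h]
          · exact cx i (by omega)
        · rw [State.real_writeNat, State.real_writeNat, w, if_neg (by omega), cx' i (by omega)]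
  · have := succ_le_sortTime n
    rw [a1]
    simp only [cost, NExp.cost, RExp.cost, NExp.var, RExp.var, Test.cost]
    omega

end RealRAM

/-! ### Common neighbours in the box [-1,1]² -/

namespace UnitSquare

/-- The unit squares around the points `a` and `b` have a common neighbour, where a square is
counted as its own neighbour. -/
def Linked (X Y : ℕ → ℝ) (n a b : ℕ) : Prop :=
  ∃ p < n, (|X p - X a| ≤ 1 ∧ |Y p - Y a| ≤ 1) ∧ |X p - X b| ≤ 1 ∧ |Y p - Y b| ≤ 1

theorem Linked.symm {X Y : ℕ → ℝ} {n a b : ℕ} (h : Linked X Y n a b) : Linked X Y n b a := by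
  obtain ⟨p, hp, h1, h2⟩ := h
  exact ⟨p, hp, h2, h1⟩

theorem Linked.swap {X Y : ℕ → ℝ} {n a b : ℕ} (h : Linked X Y n a b) : Linked Y X n a b := by
  obtain ⟨p, hp, h1, h2⟩ := h
  exact ⟨p, hp, h1.symm, h2.symm⟩

/-- There is a bad pair for some choice of the signs. -/
def HasBadPair (X Y : ℕ → ℝ) (n : ℕ) : Prop :=
  ∃ τ τ' : ℝ, (τ = 1 ∨ τ = -1) ∧ (τ' = 1 ∨ τ' = -1) ∧ ∃ b < n, ∃ a < n, BadPair τ τ' X Y n a b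

/-- The four negated conditions rule out the four quadrants a common neighbour could lie in. In each
of them, the inequalities not listed in `Near` follow from the signs and from the box. -/
theorem badPair_iff {X Y : ℕ → ℝ} {n a b : ℕ} {τ τ' : ℝ} (hτ : τ = 1 ∨ τ = -1)
    (hτ' : τ' = 1 ∨ τ' = -1) (hX : ∀ i < n, |X i| ≤ 1) (hY : ∀ i < n, |Y i| ≤ 1) (ha : a < n)
    (hb : b < n) (h1 : X a ≤ 0) (h2 : 0 ≤ X b) (h3 : 0 ≤ τ * Y a) (h4 : 0 ≤ τ' * Y b) :
    BadPair τ τ' X Y n a b ↔ ¬ Linked X Y n a b := by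
  have xa := abs_le.1 (hX a ha)
  have xb := abs_le.1 (hX b hb)
  have ya := abs_le.1 (hY a ha)
  have yb := abs_le.1 (hY b hb)
  constructor
  · rintro ⟨-, -, -, -, -, h5, h6, h7, h8⟩ ⟨p, hp, ⟨p1, p2⟩, p3, p4⟩
    have xp := abs_le.1 (hX p hp)
    have yp := abs_le.1 (hY p hp)
    rw [abs_le] at p1 p2 p3 p4
    rcases le_total (X p) 0 with hxp | hxp
    · rcases le_total 0 (τ * Y p) with hyp | hyp
      -- Here `p` shares the quadrant of `a`, so only `b` matters and the height bound is the
      -- trivial 1.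
      · refine h7 ⟨p, hp, by linarith, hyp, by linarith, ?_, ?_⟩ <;>
          rcases hτ with rfl | rfl <;> linarith
      · refine h6 ⟨p, hp, by linarith, by linarith, by linarith, ?_, ?_⟩ <;>
          rcases hτ with rfl | rfl <;> linarith
    · rcases le_total 0 (τ' * Y p) with hyp | hyp
      · refine h5 ⟨p, hp, by linarith, hyp, by linarith, ?_, ?_⟩ <;>
          rcases hτ' with rfl | rfl <;> linarith
      · refine h8 ⟨p, hp, by linarith, by linarith, by linarith, ?_, ?_⟩ <;>
          rcases hτ' with rfl | rfl <;> linarith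
  · intro h
    have h5 : τ' * Y b ≤ 1 := by rcases hτ' with rfl | rfl <;> linarith
    refine ⟨h1, h3, h2, h4, h5, ?_, ?_, ?_, ?_⟩ <;> rintro ⟨p, hp, q1, q2, q3, q4, q5⟩ <;>
      refine h ⟨p, hp, ?_⟩ <;> have xp := abs_le.1 (hX p hp) <;> have yp := abs_le.1 (hY p hp) <;>
      simp only [abs_le] <;> refine ⟨⟨⟨?_, ?_⟩, ?_, ?_⟩, ⟨?_, ?_⟩, ?_, ?_⟩ <;>
      rcases hτ with rfl | rfl <;> rcases hτ' with rfl | rfl <;> linarith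

theorem exists_sign (y : ℝ) : ∃ τ : ℝ, (τ = 1 ∨ τ = -1) ∧ 0 ≤ τ * y := by
  rcases le_total 0 y with h | h
  · exact ⟨1, .inl rfl, by linarith⟩
  · exact ⟨-1, .inr rfl, by linarith⟩

/-- Two points of the box not separated by an axis are adjacent, and one of them serves as common
neighbour. A separated pair is handled by `badPair_iff`, with the coordinates exchanged if the
separating axis is horizontal. -/
theorem forall_linked_iff {X Y : ℕ → ℝ} {n : ℕ} (hX : ∀ i < n, |X i| ≤ 1)
    (hY : ∀ i < n, |Y i| ≤ 1) :
    (∀ a < n, ∀ b < n, Linked X Y n a b) ↔ ¬ HasBadPair X Y n ∧ ¬ HasBadPair Y X n := by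
  have aux {X Y : ℕ → ℝ} (hX : ∀ i < n, |X i| ≤ 1) (hY : ∀ i < n, |Y i| ≤ 1)
      (hbad : ¬ HasBadPair X Y n) {a b : ℕ} (ha : a < n) (hb : b < n) (h1 : X a ≤ 0)
      (h2 : 0 ≤ X b) : Linked X Y n a b := by
    by_contra h
    obtain ⟨τ, hτ, h3⟩ := exists_sign (Y a)
    obtain ⟨τ', hτ', h4⟩ := exists_sign (Y b)
    exact hbad ⟨τ, τ', hτ, hτ', b, hb, a, ha, (badPair_iff hτ hτ' hX hY ha hb h1 h2 h3 h4).2 h⟩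
  constructor
  · intro h
    constructor
    · rintro ⟨τ, τ', hτ, hτ', b, hb, a, ha, hbad⟩
      obtain ⟨h1, h3, h2, h4, -⟩ := id hbad
      exact (badPair_iff hτ hτ' hX hY ha hb h1 h2 h3 h4).1 hbad (h a ha b hb)
    · rintro ⟨τ, τ', hτ, hτ', b, hb, a, ha, hbad⟩
      obtain ⟨h1, h3, h2, h4, -⟩ := id hbad
      exact (badPair_iff hτ hτ' hY hX ha hb h1 h2 h3 h4).1 hbad (h a ha b hb).swap
  · rintro ⟨hbad, hbad'⟩ a ha b hb
    have xa := abs_le.1 (hX a ha)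
    have xb := abs_le.1 (hX b hb)
    have ya := abs_le.1 (hY a ha)
    have yb := abs_le.1 (hY b hb)
    by_cases h : |X a - X b| ≤ 1 ∧ |Y a - Y b| ≤ 1
    · exact ⟨a, ha, by simp, h⟩
    · simp only [abs_le] at h
      rcases le_total (X a) 0 with h1 | h1 <;> rcases le_total (X b) 0 with h2 | h2
      · rcases le_total (Y a) 0 with h3 | h3 <;> rcases le_total (Y b) 0 with h4 | h4
        · exact absurd ⟨⟨by linarith, by linarith⟩, by linarith, by linarith⟩ h
        · exact (aux hY hX hbad' ha hb h3 h4).swap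
        · exact (aux hY hX hbad' hb ha h4 h3).swap.symm
        · exact absurd ⟨⟨by linarith, by linarith⟩, by linarith, by linarith⟩ h
      · exact aux hX hY hbad ha hb h1 h2
      · exact (aux hX hY hbad hb ha h2 h1).symm
      · rcases le_total (Y a) 0 with h3 | h3 <;> rcases le_total (Y b) 0 with h4 | h4
        · exact absurd ⟨⟨by linarith, by linarith⟩, by linarith, by linarith⟩ h
        · exact (aux hY hX hbad' ha hb h3 h4).swap
        · exact (aux hY hX hbad' hb ha h4 h3).swap.symm
        · exact absurd ⟨⟨by linarith, by linarith⟩, by linarith, by linarith⟩ h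

/-! ### The diameter in terms of the centres -/

theorem exists_mem_intervals_iff (a b : ℝ) :
    (∃ t : ℝ, |t - a| ≤ 1 / 2 ∧ |t - b| ≤ 1 / 2) ↔ |a - b| ≤ 1 := by
  constructor
  · rintro ⟨t, h1, h2⟩
    rw [abs_le] at *
    constructor <;> linarith
  · intro h
    refine ⟨(a + b) / 2, ?_, ?_⟩ <;> rw [abs_le] at * <;> constructor <;> linarith

theorem square_inter_nonempty_iff (c d : ℝ × ℝ) :
    (square c ∩ square d).Nonempty ↔ |c.1 - d.1| ≤ 1 ∧ |c.2 - d.2| ≤ 1 := by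
  rw [← exists_mem_intervals_iff, ← exists_mem_intervals_iff]
  constructor
  · rintro ⟨p, h1, h2⟩
    exact ⟨⟨p.1, h1.1, h2.1⟩, p.2, h1.2, h2.2⟩
  · rintro ⟨⟨t, h1, h2⟩, u, h3, h4⟩
    exact ⟨(t, u), ⟨h1, h3⟩, h2, h4⟩

/-- A nonempty set meets itself, so walks of length less than two also have a middle vertex `w`,
which may coincide with an end. -/
theorem edist_le_two_iff {F : Set (Set (ℝ × ℝ))} (hF : ∀ u ∈ F, u.Nonempty) (u v : F) :
    (intersectionGraph F).edist u v ≤ 2 ↔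
      ∃ w : F, ((w : Set (ℝ × ℝ)) ∩ u).Nonempty ∧ ((w : Set (ℝ × ℝ)) ∩ v).Nonempty := by
  have adj {u v : F} (h : ((u : Set (ℝ × ℝ)) ∩ v).Nonempty) :
      ∃ p : (intersectionGraph F).Walk u v, p.length ≤ 1 := by
    by_cases huv : u = v
    · subst huv
      exact ⟨.nil, by simp⟩
    · have hadj : (intersectionGraph F).Adj u v := ⟨huv, h⟩
      exact ⟨hadj.toWalk, by simp⟩
  have self (u : F) : ((u : Set (ℝ × ℝ)) ∩ u).Nonempty := by
    rw [Set.inter_self]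
    exact hF u u.2
  constructor
  · intro h
    have hne : (intersectionGraph F).edist u v ≠ ⊤ := ne_top_of_le_ne_top (by simp) h
    obtain ⟨p, hp⟩ := SimpleGraph.exists_walk_of_edist_ne_top hne
    rw [← hp] at h
    have hlen : p.length ≤ 2 := by exact_mod_cast h
    match p, hlen with
    | .nil, _ => exact ⟨u, self u, self u⟩
    | .cons h1 .nil, _ => exact ⟨u, self u, h1.2⟩
    | .cons (v := w) h1 (.cons h2 .nil), _ => exact ⟨w, by rw [Set.inter_comm]; exact h1.2, h2.2⟩
    | .cons _ (.cons _ (.cons _ _)), h => simp only [SimpleGraph.Walk.length_cons] at h; omega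
  · rintro ⟨w, h1, h2⟩
    rw [Set.inter_comm] at h1
    obtain ⟨p, hp⟩ := adj h1
    obtain ⟨q, hq⟩ := adj h2
    refine ((p.append q).edist_le).trans ?_
    rw [SimpleGraph.Walk.length_append]
    exact_mod_cast (by omega : p.length + q.length ≤ 2)

/-- Repeated centres give one vertex only; this is harmless because the condition on indices depends
only on their squares. -/
theorem ediam_le_two_iff {n : ℕ} (c : Fin n → ℝ × ℝ) :
    (intersectionGraph (squares c)).ediam ≤ 2 ↔ ∀ i j, ∃ k,
      (|(c k).1 - (c i).1| ≤ 1 ∧ |(c k).2 - (c i).2| ≤ 1) ∧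
        |(c k).1 - (c j).1| ≤ 1 ∧ |(c k).2 - (c j).2| ≤ 1 := by
  have hne : ∀ u ∈ squares c, u.Nonempty := by
    rintro _ ⟨i, rfl⟩
    exact ⟨c i, by simp [square]⟩
  rw [SimpleGraph.ediam_le_iff]
  constructor
  · intro h i j
    obtain ⟨⟨_, k, rfl⟩, h1, h2⟩ :=
      (edist_le_two_iff hne ⟨_, i, rfl⟩ ⟨_, j, rfl⟩).1 (h _ _)
    exact ⟨k, (square_inter_nonempty_iff _ _).1 h1, (square_inter_nonempty_iff _ _).1 h2⟩
  · rintro h ⟨_, i, rfl⟩ ⟨_, j, rfl⟩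
    obtain ⟨k, h1, h2⟩ := h i j
    exact (edist_le_two_iff hne _ _).2 ⟨⟨_, k, rfl⟩, (square_inter_nonempty_iff _ _).2 h1,
      (square_inter_nonempty_iff _ _).2 h2⟩

end UnitSquare

/-! ### The complete algorithm -/

open UnitSquare

namespace RealRAM

open Program

namespace Program

/-- Set the answer to zero if there is a bad pair for some choice of the signs. -/
def halves (x y : ℕ) : Program :=
  .seq (near 1 1 x y 7) (.seq (near 1 (-1) x y 8) (.seq (near (-1) 1 x y 9)
    (.seq (near (-1) (-1) x y 10)
      (.seq (pairs 1 1 x y 9 10 7 8) (.seq (pairs 1 (-1) x y 10 9 7 8)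
        (.seq (pairs (-1) 1 x y 9 10 8 7) (pairs (-1) (-1) x y 10 9 8 7)))))))

/-- Decide whether the diameter of the intersection graph of unit squares is at most two. -/
def diameterTwo : Program :=
  .seq (.seq (.setNat 1 (.const 0) (.get 0 (.const 0))) (.setNat 0 (.const 0) (.const 1)))
    (.seq (centre 0) (.seq (centre 1) (.seq (halves 0 1) (halves 1 0))))

end Program

theorem near_keepsNat {σ τ : ℚ} {x y f a : ℕ} (h : a < 2) : (near σ τ x y f).KeepsNat a := by
  have := prefixMin_keepsNat (a := a) (by omega)
  simp [near, nearInit, nearRead, forRange, KeepsNat, this]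
  omega

theorem near_keepsReal {σ τ : ℚ} {x y f a : ℕ} (h : a < 2 ∨ 5 < a) (hf : f ≠ a) :
    (near σ τ x y f).KeepsReal a := by
  have := prefixMin_keepsReal (a := a) (by omega)
  simp [near, nearInit, nearRead, forRange, KeepsReal, this, hf]
  omega

theorem pairs_keepsNat {τ τ' : ℚ} {x y f₁ f₂ g₁ g₂ : ℕ} :
    (pairs τ τ' x y f₁ f₂ g₁ g₂).KeepsNat 1 := by
  have := prefixMin_keepsNat (a := 1) (by omega)
  simp [pairs, pairInit, pairRead, forRange, KeepsNat, this]

theorem pairs_keepsReal {τ τ' : ℚ} {x y f₁ f₂ g₁ g₂ a : ℕ} (h : a < 2 ∨ 5 < a) :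
    (pairs τ τ' x y f₁ f₂ g₁ g₂).KeepsReal a := by
  have := prefixMin_keepsReal (a := a) (by omega)
  simp [pairs, pairInit, pairRead, forRange, KeepsReal, this]
  omega

theorem Runs.keepReals {p : Program} {s : State} {T : ℕ} {Q : State → Prop} (h : Runs p s T Q)
    {S : Set ℕ} (hS : ∀ a ∈ S, p.KeepsReal a) :
    Runs p s T fun s' => Q s' ∧ ∀ a ∈ S, s'.real a = s.real a := by
  obtain ⟨t, s', e, ht, hq⟩ := h
  exact ⟨t, s', e, ht, hq, fun a ha => e.real_eq (hS a ha)⟩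

theorem ite_eq_of_or₄ {α : Type*} {a b c d : Prop} [Decidable a] [Decidable b] [Decidable c]
    [Decidable d] [Decidable (a ∨ b ∨ c ∨ d)] (x y : α) :
    (if a then x else if b then x else if c then x else if d then x else y) =
      if a ∨ b ∨ c ∨ d then x else y := by
  by_cases a <;> by_cases b <;> by_cases c <;> by_cases d <;> simp [*]

open Classical in
-- Four tables of least heights, one per quadrant, serve all four searches: changing the sign `τ'`
-- exchanges `f₁` and `f₂`, and changing `τ` exchanges `g₁` and `g₂`.
theorem halves_runs {x y : ℕ} (hx : x < 2) (hy : y < 2) (s : State) :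
    Runs (halves x y) s (7200 * sortTime (s.nat 1 0)) fun s' =>
      s'.nat 0 0 = if HasBadPair (s.real x) (s.real y) (s.nat 1 0) then 0 else s.nat 0 0 := by
  obtain ⟨n, hn⟩ : ∃ n, n = s.nat 1 0 := ⟨_, rfl⟩
  rw [← hn]
  set X := s.real x with hX
  set Y := s.real y with hY
  have nearStep (σ τ : ℚ) {f : ℕ} (hf : 5 < f) (s' : State) (h1 : s'.nat 1 0 = n)
      (h0 : s'.nat 0 0 = s.nat 0 0) (hx' : s'.real x = X) (hy' : s'.real y = Y) :
      Runs (near σ τ x y f) s' (900 * sortTime n) fun s'' => s''.nat 1 0 = n ∧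
        s''.nat 0 0 = s.nat 0 0 ∧ s''.real x = X ∧ s''.real y = Y ∧ IsNear σ τ X Y n (s''.real f) ∧
        ∀ g, 5 < g → g ≠ f → s''.real g = s'.real g := by
    have h := near_runs (σ := σ) (τ := τ) hx hy hf s'
    rw [h1, hx', hy'] at h
    refine ((((h.keepNat (near_keepsNat (a := 1) (by decide))).keepNat
      (near_keepsNat (a := 0) (by decide)))).keepReals (S := {a | (a < 2 ∨ 5 < a) ∧ a ≠ f})
      fun a ha => near_keepsReal ha.1 ha.2.symm).mono le_rfl ?_
    rintro s'' ⟨⟨⟨hq, e1⟩, e0⟩, eR⟩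
    exact ⟨by rw [e1, h1], by rw [e0, h0], by rw [eR x ⟨.inl hx, by omega⟩, hx'],
      by rw [eR y ⟨.inl hy, by omega⟩, hy'], hq, fun g hg hgf => eR g ⟨.inr hg, hgf⟩⟩
  have pairStep (τ τ' : ℚ) {f₁ f₂ g₁ g₂ : ℕ} (hf₁ : 5 < f₁) (hf₂ : 5 < f₂) (hg₁ : 5 < g₁)
      (hg₂ : 5 < g₂) (s' : State) (h1 : s'.nat 1 0 = n) (hx' : s'.real x = X) (hy' : s'.real y = Y)
      (hF₁ : IsNear (-1) τ' X Y n (s'.real f₁)) (hF₂ : IsNear (-1) (-τ') X Y n (s'.real f₂))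
      (hG₁ : IsNear 1 τ X Y n (s'.real g₁)) (hG₂ : IsNear 1 (-τ) X Y n (s'.real g₂)) :
      Runs (pairs τ τ' x y f₁ f₂ g₁ g₂) s' (900 * sortTime n) fun s'' =>
        (s''.nat 0 0 = if ∃ b < n, ∃ a < n, BadPair τ τ' X Y n a b then 0 else s'.nat 0 0) ∧
          s''.nat 1 0 = n ∧ ∀ a, a < 2 ∨ 5 < a → s''.real a = s'.real a := by
    have h := pairs_runs (τ := τ) (τ' := τ') hx hy hf₁ hf₂ hg₁ hg₂ s'
    rw [h1, hx', hy'] at h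
    refine (((h hF₁ hF₂ hG₁ hG₂).keepNat pairs_keepsNat).keepReals (S := {a | a < 2 ∨ 5 < a})
      fun a ha => pairs_keepsReal ha).mono le_rfl ?_
    rintro s'' ⟨⟨hq, e1⟩, eR⟩
    exact ⟨hq, by rw [e1, h1], eR⟩
  rw [halves]
  refine ((nearStep 1 1 (by decide) s hn.symm rfl rfl rfl).seq (U := 6300 * sortTime n) ?_).mono
    (by omega) fun _ h => h
  rintro s₁ ⟨n₁, a₁, x₁, y₁, F₇, -⟩
  refine ((nearStep 1 (-1) (by decide) s₁ n₁ a₁ x₁ y₁).seq (U := 5400 * sortTime n) ?_).mono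
    (by omega) fun _ h => h
  rintro s₂ ⟨n₂, a₂, x₂, y₂, F₈, e₂⟩
  rw [← e₂ 7 (by decide) (by decide)] at F₇
  refine ((nearStep (-1) 1 (by decide) s₂ n₂ a₂ x₂ y₂).seq (U := 4500 * sortTime n) ?_).mono
    (by omega) fun _ h => h
  rintro s₃ ⟨n₃, a₃, x₃, y₃, F₉, e₃⟩
  rw [← e₃ 7 (by decide) (by decide)] at F₇
  rw [← e₃ 8 (by decide) (by decide)] at F₈
  refine ((nearStep (-1) (-1) (by decide) s₃ n₃ a₃ x₃ y₃).seq (U := 3600 * sortTime n) ?_).mono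
    (by omega) fun _ h => h
  rintro s₄ ⟨n₄, a₄, x₄, y₄, F₁₀, e₄⟩
  rw [← e₄ 7 (by decide) (by decide)] at F₇
  rw [← e₄ 8 (by decide) (by decide)] at F₈
  rw [← e₄ 9 (by decide) (by decide)] at F₉
  push_cast at F₇ F₈ F₉ F₁₀
  refine ((pairStep 1 1 (by decide) (by decide) (by decide) (by decide) s₄ n₄ x₄ y₄
    (by simpa using F₉) (by simpa using F₁₀) (by simpa using F₇) (by simpa using F₈)).seq (U := 2700 * sortTime n)
      ?_).mono (by omega) fun _ h => h
  rintro s₅ ⟨a₅, n₅, e₅⟩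
  have x₅ := (e₅ x (.inl hx)).trans x₄
  have y₅ := (e₅ y (.inl hy)).trans y₄
  rw [← e₅ 7 (by decide)] at F₇
  rw [← e₅ 8 (by decide)] at F₈
  rw [← e₅ 9 (by decide)] at F₉
  rw [← e₅ 10 (by decide)] at F₁₀
  refine ((pairStep 1 (-1) (by decide) (by decide) (by decide) (by decide) s₅ n₅ x₅ y₅
    (by simpa using F₁₀) (by simpa using F₉) (by simpa using F₇) (by simpa using F₈)).seq
      (U := 1800 * sortTime n) ?_).mono (by omega) fun _ h => h
  rintro s₆ ⟨a₆, n₆, e₆⟩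
  have x₆ := (e₆ x (.inl hx)).trans x₅
  have y₆ := (e₆ y (.inl hy)).trans y₅
  rw [← e₆ 7 (by decide)] at F₇
  rw [← e₆ 8 (by decide)] at F₈
  rw [← e₆ 9 (by decide)] at F₉
  rw [← e₆ 10 (by decide)] at F₁₀
  refine ((pairStep (-1) 1 (by decide) (by decide) (by decide) (by decide) s₆ n₆ x₆ y₆
    (by simpa using F₉) (by simpa using F₁₀) (by simpa using F₈) (by simpa using F₇)).seq
      (U := 900 * sortTime n) ?_).mono (by omega) fun _ h => h
  rintro s₇ ⟨a₇, n₇, e₇⟩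
  have x₇ := (e₇ x (.inl hx)).trans x₆
  have y₇ := (e₇ y (.inl hy)).trans y₆
  rw [← e₇ 7 (by decide)] at F₇
  rw [← e₇ 8 (by decide)] at F₈
  rw [← e₇ 9 (by decide)] at F₉
  rw [← e₇ 10 (by decide)] at F₁₀
  refine (pairStep (-1) (-1) (by decide) (by decide) (by decide) (by decide) s₇ n₇ x₇ y₇
    (by simpa using F₁₀) (by simpa using F₉) (by simpa using F₈) (by simpa using F₇)).mono le_rfl ?_
  rintro s₈ ⟨a₈, -, -⟩
  rw [a₈, a₇, a₆, a₅, a₄]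
  push_cast
  have split : HasBadPair X Y n ↔ (∃ b < n, ∃ a < n, BadPair (-1) (-1) X Y n a b) ∨
      (∃ b < n, ∃ a < n, BadPair (-1) 1 X Y n a b) ∨
      (∃ b < n, ∃ a < n, BadPair 1 (-1) X Y n a b) ∨
      (∃ b < n, ∃ a < n, BadPair 1 1 X Y n a b) := by
    constructor
    · rintro ⟨τ, τ', rfl | rfl, rfl | rfl, h⟩
      · exact .inr (.inr (.inr h))
      · exact .inr (.inr (.inl h))
      · exact .inr (.inl h)
      · exact .inl h
    · rintro (h | h | h | h)
      · exact ⟨_, _, .inr rfl, .inr rfl, h⟩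
      · exact ⟨_, _, .inr rfl, .inl rfl, h⟩
      · exact ⟨_, _, .inl rfl, .inr rfl, h⟩
      · exact ⟨_, _, .inl rfl, .inl rfl, h⟩
  rw [if_congr split rfl rfl, ite_eq_of_or₄]

theorem halves_keepsNat {x y : ℕ} : (halves x y).KeepsNat 1 := by
  simp [halves, KeepsNat, near_keepsNat, pairs_keepsNat]

theorem halves_keepsReal {x y a : ℕ} (h : a < 2) : (halves x y).KeepsReal a := by
  simp only [halves, KeepsReal]
  refine ⟨?_, ?_, ?_, ?_, ?_, ?_, ?_, ?_⟩ <;>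
    first | exact near_keepsReal (.inl h) (by omega) | exact pairs_keepsReal (.inl h)

/-- A point with a coordinate above 1 is more than 2 away from the one where that coordinate is -1,
so these two have no common neighbour. Otherwise the box lemma applies. The disjuncts are ordered
like the nested conditionals left by the successive overwritings of the answer. -/
theorem ediam_le_two_iff_of_shift {n : ℕ} (c : Fin n → ℝ × ℝ) {X Y : ℕ → ℝ} {m l : ℝ}
    (hX : ∀ i : Fin n, X i = (c i).1 - m - 1 ∧ m ≤ (c i).1)
    (hY : ∀ i : Fin n, Y i = (c i).2 - l - 1 ∧ l ≤ (c i).2)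
    (minX : 0 < n → ∃ i < n, X i = -1) (minY : 0 < n → ∃ i < n, Y i = -1) :
    (intersectionGraph (squares c)).ediam ≤ 2 ↔ ¬ (HasBadPair Y X n ∨ HasBadPair X Y n ∨
      (∃ i < n, 1 < Y i) ∨ ∃ i < n, 1 < X i) := by
  have hdiam : (intersectionGraph (squares c)).ediam ≤ 2 ↔ ∀ a < n, ∀ b < n, Linked X Y n a b := by
    rw [ediam_le_two_iff]
    have link (i j : Fin n) : Linked X Y n i j ↔ ∃ k,
        (|(c k).1 - (c i).1| ≤ 1 ∧ |(c k).2 - (c i).2| ≤ 1) ∧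
          |(c k).1 - (c j).1| ≤ 1 ∧ |(c k).2 - (c j).2| ≤ 1 := by
      have dx (k i : Fin n) : X k - X i = (c k).1 - (c i).1 := by
        rw [(hX k).1, (hX i).1]; ring
      have dy (k i : Fin n) : Y k - Y i = (c k).2 - (c i).2 := by
        rw [(hY k).1, (hY i).1]; ring
      simp only [← dx, ← dy]
      exact ⟨fun ⟨p, hp, h⟩ => ⟨⟨p, hp⟩, h⟩, fun ⟨k, h⟩ => ⟨k, k.2, h⟩⟩
    exact ⟨fun h a ha b hb => (link ⟨a, ha⟩ ⟨b, hb⟩).2 (h _ _),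
      fun h i j => (link i j).1 (h i i.2 j j.2)⟩
  rw [hdiam]
  by_cases hwx : ∃ i < n, 1 < X i
  · refine iff_of_false (fun h => ?_) fun h => h (.inr (.inr (.inr hwx)))
    obtain ⟨i, hi, h1⟩ := hwx
    obtain ⟨j, hj, h2⟩ := minX (by omega)
    obtain ⟨p, -, ⟨h3, -⟩, h4, -⟩ := h i hi j hj
    rw [abs_le] at h3 h4
    linarith
  by_cases hwy : ∃ i < n, 1 < Y i
  · refine iff_of_false (fun h => ?_) fun h => h (.inr (.inr (.inl hwy)))
    obtain ⟨i, hi, h1⟩ := hwy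
    obtain ⟨j, hj, h2⟩ := minY (by omega)
    obtain ⟨p, -, ⟨-, h3⟩, -, h4⟩ := h i hi j hj
    rw [abs_le] at h3 h4
    linarith
  rw [forall_linked_iff]
  · simp only [hwx, hwy, or_false, not_or]
    exact and_comm
  · intro i hi
    push Not at hwx
    have h1 := (hX ⟨i, hi⟩).1
    have h2 := (hX ⟨i, hi⟩).2
    exact abs_le.2 ⟨by simp only at h1; linarith, hwx i hi⟩
  · intro i hi
    push Not at hwy
    have h1 := (hY ⟨i, hi⟩).1
    have h2 := (hY ⟨i, hi⟩).2
    exact abs_le.2 ⟨by simp only at h1; linarith, hwy i hi⟩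

theorem diameterTwo_runs {n : ℕ} (c : Fin n → ℝ × ℝ) :
    Runs diameterTwo (input c) (20000 * sortTime n) fun s =>
      (s.answer = 0 ∨ s.answer = 1) ∧
        (s.answer = 1 ↔ (intersectionGraph (squares c)).ediam ≤ 2) := by
  classical
  rw [diameterTwo]
  refine ((Runs.of_loopFree (Q := fun s' => s'.nat 1 0 = n ∧ s'.nat 0 0 = 1 ∧
    s'.real = (input c).real) (by simp [LoopFree]) ?_).seq (U := 19000 * sortTime n) ?_).mono ?_
      fun _ h => h
  · simp [run, NExp.eval, input]
  rotate_left
  · have := succ_le_sortTime n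
    simp only [cost, NExp.cost]
    omega
  rintro s₁ ⟨n₁, a₁, e₁⟩
  have h₁ := centre_runs (x := 0) (by decide) s₁
  rw [n₁, a₁] at h₁
  refine (((h₁.keepNat (a := 1) (by simp [centre, forRange, KeepsNat])).keepReal (a := 1)
    (by simp [centre, forRange, KeepsReal])).seq (U := 18000 * sortTime n) ?_).mono (by omega)
      fun _ h => h
  rintro s₂ ⟨⟨⟨m, hm, hm', a₂⟩, k₂⟩, r₂⟩
  have n₂ : s₂.nat 1 0 = n := by rw [k₂, n₁]
  have h₂ := centre_runs (x := 1) (by decide) s₂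
  rw [n₂, a₂, r₂] at h₂
  refine (((h₂.keepNat (a := 1) (by simp [centre, forRange, KeepsNat])).keepReal (a := 0)
    (by simp [centre, forRange, KeepsReal])).seq (U := 17000 * sortTime n) ?_).mono (by omega)
      fun _ h => h
  rintro s₃ ⟨⟨⟨l, hl, hl', a₃⟩, k₃⟩, r₃⟩
  have n₃ : s₃.nat 1 0 = n := by rw [k₃, n₂]
  have h₃ := halves_runs (x := 0) (y := 1) (by decide) (by decide) s₃
  rw [n₃, a₃] at h₃
  refine ((((h₃.keepNat halves_keepsNat).keepReal (halves_keepsReal (a := 0) (by decide))).keepReal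
    (halves_keepsReal (a := 1) (by decide))).seq (U := 9000 * sortTime n) ?_).mono (by omega)
      fun _ h => h
  rintro s₄ ⟨⟨⟨a₄, k₄⟩, r₄⟩, r₄'⟩
  have h₄ := halves_runs (x := 1) (y := 0) (by decide) (by decide) s₄
  rw [show s₄.nat 1 0 = n by rw [k₄, n₃], a₄, r₄, r₄'] at h₄
  refine h₄.mono (by omega) ?_
  rintro s₅ a₅
  have hX (i : Fin n) : s₃.real 0 i = (c i).1 - m - 1 ∧ m ≤ (c i).1 := by
    obtain ⟨h1, h2⟩ := hm i i.2
    rw [r₃, h2]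
    have : s₁.real 0 i = (c i).1 := by simp [e₁, input]
    rw [this] at h1 ⊢
    exact ⟨rfl, h1⟩
  have hY (i : Fin n) : s₃.real 1 i = (c i).2 - l - 1 ∧ l ≤ (c i).2 := by
    obtain ⟨h1, h2⟩ := hl i i.2
    rw [h2]
    have : s₁.real 1 i = (c i).2 := by simp [e₁, input]
    rw [this] at h1 ⊢
    exact ⟨rfl, h1⟩
  have minX : 0 < n → ∃ i < n, s₃.real 0 i = -1 := fun h => by
    obtain ⟨i, hi, e⟩ := hm' h
    exact ⟨i, hi, by rw [r₃, (hm i hi).2, e]; ring⟩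
  have minY : 0 < n → ∃ i < n, s₃.real 1 i = -1 := fun h => by
    obtain ⟨i, hi, e⟩ := hl' h
    exact ⟨i, hi, by rw [(hl i hi).2, e]; ring⟩
  have wx : (∃ i < n, 1 < s₁.real 0 i - m - 1) ↔ ∃ i < n, 1 < s₃.real 0 i :=
    exists_congr fun i => and_congr_right fun hi => by rw [r₃, (hm i hi).2]
  have wy : (∃ i < n, 1 < s₁.real 1 i - l - 1) ↔ ∃ i < n, 1 < s₃.real 1 i :=
    exists_congr fun i => and_congr_right fun hi => by rw [(hl i hi).2]
  rw [State.answer, a₅, if_congr wx rfl rfl, if_congr wy rfl rfl, ite_eq_of_or₄,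
    ediam_le_two_iff_of_shift c hX hY minX minY]
  split_ifs with h <;> simp [h]

/-! ### The asymptotic bound -/

theorem sortTime_isBigO :
    Asymptotics.IsBigO Filter.atTop (fun n : ℕ => ((20000 * sortTime n : ℕ) : ℝ))
      (fun n : ℕ => (n : ℝ) * Real.log (n : ℝ)) := by
  -- For `n ≥ 2`, `2n + 1 ≤ 3n`, and the logarithmic factor is at most `log₂ n + 3 ≤ 4 log₂ n`.
  refine Asymptotics.IsBigO.of_bound (20000 * (3 * (4 / Real.log 2))) ?_
  filter_upwards [Filter.eventually_ge_atTop 2] with n hn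
  have hlog2 : 0 < Real.log 2 := Real.log_pos (by norm_num)
  have hn' : (2 : ℝ) ≤ n := by exact_mod_cast hn
  have hlog : Real.log 2 ≤ Real.log n := Real.log_le_log (by norm_num) hn'
  have hclog : ((Nat.clog 2 (n + n) + 1 : ℕ) : ℝ) ≤ 4 / Real.log 2 * Real.log n := by
    have h1 : Nat.clog 2 (n + n) ≤ Nat.log 2 n + 2 := by
      refine Nat.clog_le_of_le_pow ?_
      have := Nat.lt_pow_succ_log_self (b := 2) (by norm_num) n
      rw [pow_succ]
      rw [Nat.succ_eq_add_one] at this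
      omega
    have h2 : (Nat.log 2 n : ℝ) * Real.log 2 ≤ Real.log n := by
      have h3 : ((2 ^ Nat.log 2 n : ℕ) : ℝ) ≤ n := by
        exact_mod_cast Nat.pow_log_le_self 2 (by omega)
      have h4 := Real.log_le_log (by positivity) h3
      push_cast at h4
      rwa [Real.log_pow] at h4
    have h5 : ((Nat.clog 2 (n + n) + 1 : ℕ) : ℝ) ≤ Nat.log 2 n + 3 := by
      exact_mod_cast (by omega : Nat.clog 2 (n + n) + 1 ≤ Nat.log 2 n + 3)
    refine h5.trans ?_
    rw [div_mul_eq_mul_div, le_div_iff₀ hlog2]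
    linarith
  have hlin : ((n + n + 1 : ℕ) : ℝ) ≤ 3 * n := by
    push_cast
    linarith
  rw [Real.norm_of_nonneg (by positivity), Real.norm_of_nonneg
    (mul_nonneg (by linarith) (by linarith))]
  calc ((20000 * sortTime n : ℕ) : ℝ)
      = 20000 * (((n + n + 1 : ℕ) : ℝ) * ((Nat.clog 2 (n + n) + 1 : ℕ) : ℝ)) := by
        rw [sortTime, Nat.cast_mul, Nat.cast_mul]; norm_num
    _ ≤ 20000 * (3 * n * (4 / Real.log 2 * Real.log n)) := by gcongr
    _ = _ := by ring

end RealRAM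

theorem theorem3 :
    ∃ (p : RealRAM.Program) (T : ℕ → ℕ),
      Asymptotics.IsBigO Filter.atTop (fun n : ℕ => (T n : ℝ))
        (fun n : ℕ => (n : ℝ) * Real.log (n : ℝ)) ∧
      ∀ (n : ℕ) (c : Fin n → ℝ × ℝ),
        ∃ (t : ℕ) (s : RealRAM.State),
          RealRAM.Exec p (RealRAM.input c) t s ∧ t ≤ T n ∧
          (s.answer = 0 ∨ s.answer = 1) ∧
          (s.answer = 1 ↔
            (UnitSquare.intersectionGraph (UnitSquare.squares c)).ediam ≤ 2) :=
  ⟨RealRAM.Program.diameterTwo, fun n => 20000 * RealRAM.sortTime n, RealRAM.sortTime_isBigO,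
    fun _ c => RealRAM.diameterTwo_runs c⟩
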